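/- For an integer $N\ge 1$ let $\varepsilon=1/N$ and $\Lambda_N=\{-N,\dots,N\}$. **Marks.** Under $\mathbf P_\varepsilon$ the pairs $\{b,b+1\}$, $b\in\mathbb Z$, carry mutually independent Poisson point processes on $(0,\infty)$ of intensity $\varepsilon^{-2}$; their points are called marks, and each mark is independently active or passive with probability $1/2$. **Coupling.** Let $n$ be a positive integer and let $\sigma$ be a permutation of $\{1,\dots,n\}$ (the priority list); particle $i$ has priority over particle $j$ if $\sigma(i)<\sigma(j)$. Given $\underline x(0),\underline x^0(0)\in\Lambda_N^n$, where the $x_i(0)$ are distinct, the processes $\underline x(t)=(x_1(t),\dots,x_n(t))$ (stirring particles) and $\underline x^0(t)=(x^0_1(t),\dots,x^0_n(t))$ (independent particles) in $\Lambda_N^n$ are constant between marks and change as follows when a mark appears at a pair $\{b,b+1\}$; positions on the right-hand sides and in the conditions are those just before the mark. * If the mark is active and $b,b+1\in\Lambda_N$, the stirring particles at $b$ and $b+1$ (if any) exchange sites, i.e. a particle at one of the two sites moves to the other one. Otherwise $\underline x$ does not change. * If $x_i\notin\{b,b+1\}$, then $x^0_i$ does not change. If $x_i\in\{b,b+1\}$,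 let $v$ be the other site of the pair. If $v$ is occupied by a stirring particle $x_j$ having priority over $i$, then $x_i^0$ attempts the jump $x^0_i\to x^0_i+(v-x_i)$ if and only if the mark is passive. In all other cases ($v$ is empty, or $v\notin\Lambda_N$, or $v$ is occupied by a particle over which $i$ has priority) $x_i^0$ attempts this jump if and only if the mark is active. Attempted jumps that lead out of $\Lambda_N$ are suppressed. **Theorem.** For every $n\ge 1$, $T>0$, $\zeta>0$ and $k\in\mathbb N$ there is a constant $c$ (depending only on $n,T,\zeta,k$) such that for every $N\ge1$ with $\varepsilon=1/N$, every priority list $\sigma$, all initial positions $\underline x(0)=\underline x^0(0)\in\Lambda_N^n$ with distinct coordinates, every $\ell\in\{1,\dots,n\}$ and every $t\in(0,T]$, $$\mathbf P_\varepsilon\Big[\,|x_\ell(t)-x^0_\ell(t)|\ \ge\ (\varepsilon^{-2}t)^{1/4+\zeta}\Big]\ \le\ c\,(\varepsilon^{-2}t)^{-k}.$$ -/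

import Mathlib

open MeasureTheory ProbabilityTheory

/-! ### The active/passive marks process -/

/-- Sample space of the marks. The pair of sites `{b, b + 1}` is indexed by `b : ℤ`. The entry
`ω (b, m)` consists of the waiting time between the mark number `m - 1` (time `0` if `m = 0`) and
the mark number `m` at the pair `{b, b + 1}`, and of the attribute of the mark number `m`
(`true`: active, `false`: passive). -/
abbrev MarkSpace : Type := ℤ × ℕ → ℝ × Bool

/-- Law of the marks: the pairs `{b, b + 1}`, `b ∈ ℤ`, carry mutually independent Poisson
processes of intensity `r` (i.i.d. exponential waiting times of rate `r`), and each mark is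
independently active or passive with probability `1 / 2`. -/
noncomputable def marksLaw (r : ℝ) : Measure MarkSpace :=
  Measure.infinitePi fun _ : ℤ × ℕ =>
    (expMeasure r).prod (PMF.uniformOfFintype Bool).toMeasure

theorem isProbabilityMeasure_marksLaw {r : ℝ} (hr : 0 < r) :
    IsProbabilityMeasure (marksLaw r) := by
  have := isProbabilityMeasure_expMeasure hr
  unfold marksLaw
  infer_instance

/-- The time of the mark number `p.2` (counted from `0`) at the pair `{p.1, p.1 + 1}`. -/
def markTime (ω : MarkSpace) (p : ℤ × ℕ) : ℝ :=
  ∑ i ∈ Finset.range (p.2 + 1), (ω (p.1, i)).1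

/-- The marks up to time `t` at the pairs `{b, b + 1}` that intersect `Λ_N = {-N, …, N}`. -/
def marksUpTo (N : ℕ) (ω : MarkSpace) (t : ℝ) : Set (ℤ × ℕ) :=
  {p | -(N : ℤ) - 1 ≤ p.1 ∧ p.1 ≤ N ∧ markTime ω p ≤ t}

open Classical in
/-- The marks of `marksUpTo N ω t` in chronological order, each one given as the index `b` of its
pair `{b, b + 1}` together with its attribute. With probability one there are finitely many of
them, at distinct times (the value `[]` in the other case is irrelevant). -/
noncomputable def chronologicalMarks (N : ℕ) (ω : MarkSpace) (t : ℝ) : List (ℤ × Bool) :=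
  if h : (marksUpTo N ω t).Finite then
    (h.toFinset.toList.mergeSort fun p q => decide (markTime ω p ≤ markTime ω q)).map
      fun p => (p.1, (ω p).2)
  else []

/-! ### The effect of a single mark on stirring and on independent particles -/

/-- Effect of a mark at `{b, b + 1}` on the stirring particles: if the mark is active and both
`b` and `b + 1` are in `Λ_N`, then the contents of `b` and `b + 1` are exchanged. -/
def stirringStep (N : ℕ) {n : ℕ} (b : ℤ) (active : Bool) (x : Fin n → ℤ) : Fin n → ℤ :=
  if active = true ∧ -(N : ℤ) ≤ b ∧ b + 1 ≤ N then fun i => Equiv.swap b (b + 1) (x i) else x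

/-- Jump attempted by the `i`-th independent particle because of a mark at `{b, b + 1}`, when the
stirring particles are at `x` just before the mark. Particle `i` attempts a jump only if its
stirring partner is at `b` or `b + 1`, and the attempted jump is then directed from the position of
that partner to the other site of the pair. If the other site is occupied by a stirring particle
with priority over `i`, the jump is attempted iff the mark is passive; if the other site is empty,
outside `Λ_N`, or occupied by a stirring particle over which `i` has priority, the jump is
attempted iff the mark is active. -/
def attemptedJump {n : ℕ} (σ : Equiv.Perm (Fin n)) (b : ℤ) (active : Bool) (x : Fin n → ℤ)
    (i : Fin n) : ℤ :=
  if x i = b then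
    if ∃ j, x j = b + 1 ∧ σ j < σ i then
      if active = false then 1 else 0
    else
      if active = true then 1 else 0
  else if x i = b + 1 then
    if ∃ j, x j = b ∧ σ j < σ i then
      if active = false then -1 else 0
    else
      if active = true then -1 else 0
  else 0

/-- Effect of a mark at `{b, b + 1}` on the independent particles at `z`, when the stirring
particles are at `x` just before the mark: the attempted jump is performed unless it leads out
of `Λ_N`. -/
def independentStep (N : ℕ) {n : ℕ} (σ : Equiv.Perm (Fin n)) (b : ℤ) (active : Bool)
    (x z : Fin n → ℤ) : Fin n → ℤ :=
  let y : Fin n → ℤ := fun i => z i + attemptedJump σ b active x i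
  if ∀ i, -(N : ℤ) ≤ y i ∧ y i ≤ N then y else z

/-- Effect of a mark on the pair (stirring particles, independent particles). -/
def couplingStep (N : ℕ) {n : ℕ} (σ : Equiv.Perm (Fin n))
    (c : (Fin n → ℤ) × (Fin n → ℤ)) (mark : ℤ × Bool) : (Fin n → ℤ) × (Fin n → ℤ) :=
  (stirringStep N mark.1 mark.2 c.1, independentStep N σ mark.1 mark.2 c.1 c.2)

/-! ### The coupled processes -/

/-- State at time `t` of the coupled process which starts from the stirring configuration `x` and
the independent configuration `z`: the marks up to time `t` are applied in chronological order. -/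
noncomputable def coupledProcess (N : ℕ) {n : ℕ} (σ : Equiv.Perm (Fin n)) (x z : Fin n → ℤ)
    (ω : MarkSpace) (t : ℝ) : (Fin n → ℤ) × (Fin n → ℤ) :=
  (chronologicalMarks N ω t).foldl (couplingStep N σ) (x, z)

/-- The labeled stirring particles `x(t)` of the coupled process. -/
noncomputable def stirringPosition (N : ℕ) {n : ℕ} (σ : Equiv.Perm (Fin n)) (x z : Fin n → ℤ)
    (ω : MarkSpace) (t : ℝ) : Fin n → ℤ :=
  (coupledProcess N σ x z ω t).1

/-- The independent particles `x⁰(t)` of the coupled process. -/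
noncomputable def independentPosition (N : ℕ) {n : ℕ} (σ : Equiv.Perm (Fin n)) (x z : Fin n → ℤ)
    (ω : MarkSpace) (t : ℝ) : Fin n → ℤ :=
  (coupledProcess N σ x z ω t).2

/-!
The discrepancy `D = x_ℓ - x⁰_ℓ` can grow only at marks which find the `ℓ`-th stirring particle next
to a particle of higher priority. There it makes a symmetric `±1` step, and otherwise the two
particles make the same move, up to the projection onto `Λ_N`, which is `1`-Lipschitz. The time
spent by stirring particles next to each other is dominated by the drift of the potential
`Φ(x) = ∑ i, ∑ j, (|x i - x j| - (x i ^ 2 + x j ^ 2) / N)`, up to an error of order `1 / N`. Hence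
`cosh (λ D) * exp (-λ² (Φ(x(t)) - Φ(x(0))))` is nearly a supermartingale, and so is
`∑ i, cosh (λ² (x i(t) - x i(0)))`, which controls `Φ`. The claim is Markov's inequality for the sum
of both, with `λ²` of order `(ε⁻² t) ^ (-1 / 2)`. The growth of its expectation follows without any
theory of continuous-time processes, by summing the one-step bound over all lists of marks, weighted
by explicit bounds for the probabilities of these lists.
-/

section Resampling

variable {ι : Type*} [DecidableEq ι] {X : ι → Type*} [∀ i, MeasurableSpace (X i)]
  (μ : ∀ i, Measure (X i)) [∀ i, IsProbabilityMeasure (μ i)] (i : ι)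

theorem map_update_infinitePi :
    ((Measure.infinitePi μ).prod (μ i)).map (fun p => Function.update p.1 i p.2) =
      Measure.infinitePi μ := by
  refine Measure.eq_infinitePi _ fun s t ht => ?_
  have hpreimage : (fun p : (∀ j, X j) × X i => Function.update p.1 i p.2) ⁻¹' Set.pi s t =
      Set.pi (s.erase i : Finset ι) t ×ˢ if i ∈ s then t i else Set.univ := by
    ext ⟨ω, y⟩
    simp only [Set.mem_preimage, Set.mem_pi, Finset.mem_coe, Set.mem_prod, Finset.mem_erase]
    constructor
    · intro h
      refine ⟨fun j hj => by simpa [Function.update_of_ne hj.1] using h j hj.2, ?_⟩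
      split_ifs with hi
      · simpa using h i hi
      · trivial
    · rintro ⟨hne, heq⟩ j hj
      obtain rfl | hji := eq_or_ne j i
      · simpa [hj] using heq
      · simpa [Function.update_of_ne hji] using hne j ⟨hji, hj⟩
  rw [Measure.map_apply measurable_update' (MeasurableSet.pi s.countable_toSet fun j _ => ht j),
    hpreimage, Measure.prod_prod, Measure.infinitePi_pi _ fun j _ => ht j]
  split_ifs with hi
  · rw [Finset.prod_erase_mul _ _ hi]
  · rw [measure_univ, mul_one, Finset.erase_eq_of_notMem hi]

theorem lintegral_infinitePi_mul_le_of_resample {f g h : (∀ i, X i) → ENNReal}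
    (hf : Measurable f) (hh : ∀ ω y, h (Function.update ω i y) = h ω)
    (hfg : ∀ ω, ∫⁻ y, f (Function.update ω i y) ∂μ i ≤ g ω) :
    ∫⁻ ω, h ω * f ω ∂Measure.infinitePi μ ≤ ∫⁻ ω, h ω * g ω ∂Measure.infinitePi μ := by
  conv_lhs => rw [← map_update_infinitePi μ i]
  refine (lintegral_map_le _ _).trans ((lintegral_prod_le _).trans (lintegral_mono fun ω => ?_))
  simp only [hh]
  exact (lintegral_const_mul (h ω) (hf.comp (measurable_update ω))).trans_le
    (mul_le_mul_right (hfg ω) _)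

end Resampling

section ExponentialLaw

variable {r : ℝ}

theorem expMeasure_Ioi_le (hr : 0 < r) (s : ℝ) :
    expMeasure r (Set.Ioi s) ≤ ENNReal.ofReal (Real.exp (-(r * s))) := by
  have := isProbabilityMeasure_expMeasure hr
  rw [← ofReal_measureReal, ← Set.compl_Iic, probReal_compl_eq_one_sub measurableSet_Iic,
    ← cdf_eq_real, cdf_expMeasure_eq hr]
  refine ENNReal.ofReal_le_ofReal ?_
  split_ifs with hs
  · exact (sub_sub_cancel _ _).le
  · have := Real.one_le_exp_iff.2 (neg_nonneg.2 (mul_nonpos_of_nonneg_of_nonpos hr.le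
      (not_le.1 hs).le))
    simpa using this

theorem expMeasure_Iic_zero (hr : 0 < r) : expMeasure r (Set.Iic 0) = 0 := by
  have := isProbabilityMeasure_expMeasure hr
  rw [← measureReal_eq_zero_iff, ← cdf_eq_real, cdf_expMeasure_eq hr]
  simp

theorem lintegral_expMeasure_le (hr : 0 < r) {f : ℝ → ENNReal} (hf : Measurable f) :
    ∫⁻ x, f x ∂expMeasure r ≤ ∫⁻ x, ENNReal.ofReal (r * Real.exp (-(r * x))) * f x := by
  have hpdf : Measurable (exponentialPDF r) := (measurable_exponentialPDFReal r).ennreal_ofReal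
  refine (lintegral_withDensity_eq_lintegral_mul volume hpdf hf).trans_le
    (lintegral_mono fun x => ?_)
  simp only [Pi.mul_apply, exponentialPDF_eq]
  gcongr
  split_ifs
  · exact le_rfl
  · positivity

theorem lintegral_expMeasure_mul_exp_le (hr : 0 < r) (t τ : ℝ) {f : ℝ → ENNReal}
    (hf : Measurable f) :
    ∫⁻ x, f (τ + x) * ENNReal.ofReal (Real.exp (-(r * (t - (τ + x))))) ∂expMeasure r ≤
      ENNReal.ofReal r * (∫⁻ u, f u) * ENNReal.ofReal (Real.exp (-(r * (t - τ)))) := by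
  refine (lintegral_expMeasure_le hr (by fun_prop)).trans_eq ?_
  have htilt : ∀ x, ENNReal.ofReal (r * Real.exp (-(r * x))) *
      (f (τ + x) * ENNReal.ofReal (Real.exp (-(r * (t - (τ + x)))))) =
      ENNReal.ofReal (r * Real.exp (-(r * (t - τ)))) * f (τ + x) := fun x => by
    rw [mul_left_comm, mul_comm, ← ENNReal.ofReal_mul (by positivity), mul_assoc, ← Real.exp_add]
    ring_nf
  simp only [htilt]
  rw [lintegral_const_mul' _ _ ENNReal.ofReal_ne_top, lintegral_add_left_eq_self f,
    ENNReal.ofReal_mul hr.le, mul_right_comm]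

end ExponentialLaw

/-- The law of one entry of the marks: an exponential waiting time and an independent fair
attribute. -/
noncomputable def markLaw (r : ℝ) : Measure (ℝ × Bool) :=
  (expMeasure r).prod (PMF.uniformOfFintype Bool).toMeasure

theorem isProbabilityMeasure_markLaw {r : ℝ} (hr : 0 < r) :
    IsProbabilityMeasure (markLaw r) := by
  have := isProbabilityMeasure_expMeasure hr
  unfold markLaw
  infer_instance

theorem lintegral_marksLaw_mul_le_of_resample {r : ℝ} (hr : 0 < r) (p : ℤ × ℕ)
    {f g h : MarkSpace → ENNReal} (hf : Measurable f)
    (hh : ∀ ω y, h (Function.update ω p y) = h ω)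
    (hfg : ∀ ω, ∫⁻ y, f (Function.update ω p y) ∂markLaw r ≤ g ω) :
    ∫⁻ ω, h ω * f ω ∂marksLaw r ≤ ∫⁻ ω, h ω * g ω ∂marksLaw r :=
  have := isProbabilityMeasure_markLaw hr
  lintegral_infinitePi_mul_le_of_resample (fun _ : ℤ × ℕ => markLaw r) p hf hh hfg

theorem map_fst_markLaw {r : ℝ} (hr : 0 < r) : (markLaw r).map Prod.fst = expMeasure r := by
  have := isProbabilityMeasure_expMeasure hr
  rw [markLaw, Measure.map_fst_prod, measure_univ, one_smul]

theorem lintegral_markLaw_snd_eq {r : ℝ} (hr : 0 < r) (a : Bool) {f : ℝ → ENNReal}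
    (hf : Measurable f) :
    ∫⁻ y, (if y.2 = a then f y.1 else 0) ∂markLaw r = 2⁻¹ * ∫⁻ x, f x ∂expMeasure r := by
  have := isProbabilityMeasure_expMeasure hr
  have hmul : ∀ y : ℝ × Bool,
      (if y.2 = a then f y.1 else 0) = f y.1 * Set.indicator {a} 1 y.2 := fun y => by
    simp [Set.indicator_apply]
  simp only [hmul]
  rw [markLaw, lintegral_prod_mul hf.aemeasurable (measurable_of_countable _).aemeasurable,
    lintegral_indicator_one (measurableSet_singleton a),
    PMF.toMeasure_apply_singleton _ _ (measurableSet_singleton a), mul_comm]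
  simp

theorem ae_waitingTime_pos {r : ℝ} (hr : 0 < r) :
    ∀ᵐ ω ∂marksLaw r, ∀ p : ℤ × ℕ, 0 < (ω p).1 := by
  have := isProbabilityMeasure_markLaw hr
  refine ae_all_iff.2 fun p => ?_
  have hfst : ∀ᵐ y ∂markLaw r, 0 < y.1 := by
    refine ae_of_ae_map measurable_fst.aemeasurable (p := fun s => 0 < s) ?_
    rw [map_fst_markLaw hr, ae_iff]
    simp only [not_lt]
    exact expMeasure_Iic_zero hr
  exact (measurePreserving_eval_infinitePi
    (fun _ : ℤ × ℕ => markLaw r) p).quasiMeasurePreserving.ae hfst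

/-- The time of the mark number `k` at the pair `{b, b + 1}`, where marks are counted from `1` and
the mark number `0` is placed at time `0` (in `markTime` they are counted from `0`). -/
def arrivalTime (ω : MarkSpace) (b : ℤ) (k : ℕ) : ℝ := ∑ i ∈ Finset.range k, (ω (b, i)).1

theorem markTime_eq_arrivalTime (ω : MarkSpace) (b : ℤ) (k : ℕ) :
    markTime ω (b, k) = arrivalTime ω b (k + 1) := rfl

theorem measurable_arrivalTime (b : ℤ) (k : ℕ) : Measurable fun ω => arrivalTime ω b k :=
  Finset.measurable_sum _ fun i _ => measurable_fst.comp (measurable_pi_apply (b, i))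

theorem arrivalTime_update_of_le (ω : MarkSpace) {b b' : ℤ} {i k : ℕ} (y : ℝ × Bool)
    (h : b' = b → k ≤ i) :
    arrivalTime (Function.update ω (b, i) y) b' k = arrivalTime ω b' k := by
  refine Finset.sum_congr rfl fun j hj => ?_
  rw [Function.update_of_ne]
  rintro ⟨⟩
  exact (Finset.mem_range.1 hj).not_ge (h rfl)

theorem arrivalTime_update_succ (ω : MarkSpace) (b : ℤ) (i : ℕ) (y : ℝ × Bool) :
    arrivalTime (Function.update ω (b, i) y) b (i + 1) = arrivalTime ω b i + y.1 := by
  rw [← arrivalTime_update_of_le ω y fun _ => le_rfl, arrivalTime, Finset.sum_range_succ,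
    Function.update_self, arrivalTime]

section Histories

/-- The number of marks at the pair `{b, b + 1}` in the list of marks `w`. -/
def markCount (w : List (ℤ × Bool)) (b : ℤ) : ℕ := (w.map Prod.fst).count b

theorem markCount_cons (l : ℤ × Bool) (w : List (ℤ × Bool)) (b : ℤ) :
    markCount (l :: w) b = markCount w b + if l.1 = b then 1 else 0 := by
  simp [markCount, List.count_cons]

theorem markCount_cons_self (b : ℤ) (a : Bool) (w : List (ℤ × Bool)) :
    markCount ((b, a) :: w) b = markCount w b + 1 := by
  simp [markCount_cons]

theorem markCount_cons_of_ne {b b' : ℤ} (h : b' ≠ b) (a : Bool) (w : List (ℤ × Bool)) :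
    markCount ((b, a) :: w) b' = markCount w b' := by
  simp [markCount_cons, h.symm]

/-- The time of the most recent mark if the marks so far, the most recent one first, are `w`. -/
def lastTime (ω : MarkSpace) : List (ℤ × Bool) → ℝ
  | [] => 0
  | l :: w => arrivalTime ω l.1 (markCount w l.1 + 1)

/-- `w` lists marks of `ω`, the most recent one first: at each pair of sites these are the first
marks of `ω`, with their attributes, and their times are in the order of the list. -/
def IsRecord (ω : MarkSpace) : List (ℤ × Bool) → Prop
  | [] => True
  | l :: w => IsRecord ω w ∧ lastTime ω w ≤ lastTime ω (l :: w) ∧ (ω (l.1, markCount w l.1)).2 = l.2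

/-- The marks of `ω` up to time `t` at the pairs of sites in `B`, the most recent one first,
are `w`. -/
def IsHistory (t : ℝ) (B : Finset ℤ) (w : List (ℤ × Bool)) (ω : MarkSpace) : Prop :=
  IsRecord ω w ∧ lastTime ω w ≤ t ∧ ∀ b ∈ B, t < arrivalTime ω b (markCount w b + 1)

theorem measurable_lastTime (w : List (ℤ × Bool)) : Measurable fun ω => lastTime ω w := by
  cases w with
  | nil => exact measurable_const
  | cons l w => exact measurable_arrivalTime _ _

theorem measurableSet_isRecord (w : List (ℤ × Bool)) : MeasurableSet {ω | IsRecord ω w} := by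
  induction w with
  | nil => exact MeasurableSet.univ
  | cons l w ih =>
    exact ih.inter ((measurableSet_le (measurable_lastTime w) (measurable_lastTime (l :: w))).inter
      ((measurable_snd.comp (measurable_pi_apply _)) (measurableSet_singleton l.2)))

theorem measurableSet_isHistory (t : ℝ) (B : Finset ℤ) (w : List (ℤ × Bool)) :
    MeasurableSet {ω | IsHistory t B w ω} := by
  have hlate : MeasurableSet
      {ω : MarkSpace | ∀ b ∈ B, t < arrivalTime ω b (markCount w b + 1)} := by
    simp only [Set.ofPred_forall]
    exact Finset.measurableSet_biInter B fun b _ =>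
      measurableSet_lt measurable_const (measurable_arrivalTime b _)
  exact (measurableSet_isRecord w).inter
    ((measurableSet_le (measurable_lastTime w) measurable_const).inter hlate)

theorem lastTime_update (ω : MarkSpace) (w : List (ℤ × Bool)) {b : ℤ} {i : ℕ}
    (h : markCount w b ≤ i) (y : ℝ × Bool) :
    lastTime (Function.update ω (b, i) y) w = lastTime ω w := by
  cases w with
  | nil => rfl
  | cons l w =>
    refine arrivalTime_update_of_le ω y ?_
    rintro rfl
    rwa [markCount_cons_self] at h

theorem isRecord_update (ω : MarkSpace) (w : List (ℤ × Bool)) {b : ℤ} {i : ℕ}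
    (h : markCount w b ≤ i) (y : ℝ × Bool) :
    IsRecord (Function.update ω (b, i) y) w ↔ IsRecord ω w := by
  induction w with
  | nil => rfl
  | cons l w ih =>
    have hw : markCount w b ≤ i := by
      rw [markCount_cons] at h
      exact (Nat.le_add_right _ _).trans h
    have hne : (l.1, markCount w l.1) ≠ (b, i) := by
      rintro ⟨⟩
      rw [markCount_cons_self] at h
      exact Nat.not_succ_le_self _ h
    rw [IsRecord, IsRecord, ih hw, lastTime_update ω w hw, lastTime_update ω (l :: w) h,
      Function.update_of_ne hne]

theorem lastTime_update_cons (ω : MarkSpace) (b : ℤ) (a : Bool) (w : List (ℤ × Bool))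
    (y : ℝ × Bool) :
    lastTime (Function.update ω (b, markCount w b) y) ((b, a) :: w) =
      arrivalTime ω b (markCount w b) + y.1 :=
  arrivalTime_update_succ ω b _ y

theorem isRecord_update_cons (ω : MarkSpace) (b : ℤ) (a : Bool) (w : List (ℤ × Bool))
    (y : ℝ × Bool) :
    IsRecord (Function.update ω (b, markCount w b) y) ((b, a) :: w) ↔
      IsRecord ω w ∧ lastTime ω w ≤ arrivalTime ω b (markCount w b) + y.1 ∧ y.2 = a := by
  rw [IsRecord, isRecord_update ω w le_rfl, lastTime_update ω w le_rfl, lastTime_update_cons,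
    Function.update_self]

/-- The probability that, after `k` marks at the pair `{b, b + 1}`, the next one comes after
time `t`; it exceeds `1` if the `k`-th mark comes after time `t`. -/
noncomputable def survival (r t : ℝ) (ω : MarkSpace) (b : ℤ) (k : ℕ) : ENNReal :=
  ENNReal.ofReal (Real.exp (-(r * (t - arrivalTime ω b k))))

theorem measurable_survival (r t : ℝ) (b : ℤ) (k : ℕ) :
    Measurable fun ω => survival r t ω b k := by
  have := measurable_arrivalTime b k
  unfold survival
  fun_prop

theorem survival_update_of_le (r t : ℝ) (ω : MarkSpace) {b b' : ℤ} {i k : ℕ} (y : ℝ × Bool)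
    (h : b' = b → k ≤ i) :
    survival r t (Function.update ω (b, i) y) b' k = survival r t ω b' k := by
  rw [survival, arrivalTime_update_of_le ω y h, survival]

theorem lintegral_late_le {r : ℝ} (hr : 0 < r) (t : ℝ) (ω : MarkSpace) (b : ℤ) (k : ℕ) :
    ∫⁻ y, (if t < arrivalTime (Function.update ω (b, k) y) b (k + 1) then 1 else 0) ∂markLaw r ≤
      survival r t ω b k := by
  have hlate : ∀ y : ℝ × Bool,
      (if t < arrivalTime (Function.update ω (b, k) y) b (k + 1) then (1 : ENNReal) else 0) =
        (Prod.fst ⁻¹' Set.Ioi (t - arrivalTime ω b k)).indicator 1 y := fun y => by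
    rw [arrivalTime_update_succ]
    simp [Set.indicator, sub_lt_iff_lt_add']
  simp only [hlate]
  rw [lintegral_indicator_one (measurable_fst measurableSet_Ioi),
    ← Measure.map_apply measurable_fst measurableSet_Ioi, map_fst_markLaw hr]
  exact expMeasure_Ioi_le hr _

theorem lintegral_mul_prod_late_le {r : ℝ} (hr : 0 < r) (t : ℝ) (c : ℤ → ℕ) (B : Finset ℤ)
    {h : MarkSpace → ENNReal} (hh : ∀ b ∈ B, ∀ ω y, h (Function.update ω (b, c b) y) = h ω) :
    ∫⁻ ω, h ω * ∏ b ∈ B, (if t < arrivalTime ω b (c b + 1) then 1 else 0) ∂marksLaw r ≤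
      ∫⁻ ω, h ω * ∏ b ∈ B, survival r t ω b (c b) ∂marksLaw r := by
  induction B using Finset.induction_on generalizing h with
  | empty => simp
  | insert b B hb ih =>
    calc _ = ∫⁻ ω, (h ω * ∏ x ∈ B, if t < arrivalTime ω x (c x + 1) then 1 else 0) *
          (if t < arrivalTime ω b (c b + 1) then 1 else 0) ∂marksLaw r := by
          simp only [Finset.prod_insert hb, mul_left_comm, mul_comm]
      _ ≤ ∫⁻ ω, (h ω * ∏ x ∈ B, if t < arrivalTime ω x (c x + 1) then 1 else 0) *
          survival r t ω b (c b) ∂marksLaw r := by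
          refine lintegral_marksLaw_mul_le_of_resample hr (b, c b) ?_ (fun ω y => ?_)
            fun ω => lintegral_late_le hr t ω b (c b)
          · exact Measurable.ite (measurableSet_lt measurable_const (measurable_arrivalTime b _))
              measurable_const measurable_const
          · rw [hh b (Finset.mem_insert_self b B)]
            congr 1
            refine Finset.prod_congr rfl fun x hx => ?_
            rw [arrivalTime_update_of_le ω y fun hxb : x = b => absurd (hxb ▸ hx) hb]
      _ = ∫⁻ ω, h ω * survival r t ω b (c b) *
          ∏ x ∈ B, (if t < arrivalTime ω x (c x + 1) then 1 else 0) ∂marksLaw r := by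
          simp only [mul_right_comm]
      _ ≤ ∫⁻ ω, h ω * survival r t ω b (c b) * ∏ x ∈ B, survival r t ω x (c x) ∂marksLaw r := by
          refine ih fun x hx ω y => ?_
          rw [hh x (Finset.mem_insert_of_mem hx), survival_update_of_le]
          rintro rfl
          exact le_rfl
      _ = _ := by
          simp only [Finset.prod_insert hb, mul_assoc]

open Classical in
/-- The expectation of `f` at the time of the most recent mark if the marks so far are `w`, each
pair of sites in `B` being weighted by the probability that it has no further mark until `t`. -/
noncomputable def survivalIntegral (r t : ℝ) (B : Finset ℤ) (w : List (ℤ × Bool))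
    (f : ℝ → ENNReal) : ENNReal :=
  ∫⁻ ω, (if IsRecord ω w then f (lastTime ω w) else 0) *
    ∏ b ∈ B, survival r t ω b (markCount w b) ∂marksLaw r

open Classical in
theorem lintegral_next_mark_le {r : ℝ} (hr : 0 < r) (t : ℝ) (ω : MarkSpace) (b : ℤ) (a : Bool)
    (w : List (ℤ × Bool)) {f : ℝ → ENNReal} (hf : Measurable f) :
    ∫⁻ y, (if IsRecord (Function.update ω (b, markCount w b) y) ((b, a) :: w) then
        f (lastTime (Function.update ω (b, markCount w b) y) ((b, a) :: w)) else 0) *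
        survival r t (Function.update ω (b, markCount w b) y) b (markCount w b + 1) ∂markLaw r ≤
      ENNReal.ofReal (r / 2) * (if IsRecord ω w then ∫⁻ u in Set.Ici (lastTime ω w), f u else 0) *
        survival r t ω b (markCount w b) := by
  by_cases hw : IsRecord ω w
  · set τ := arrivalTime ω b (markCount w b)
    set φ := (Set.Ici (lastTime ω w)).indicator f with hφ
    have hφm : Measurable φ := hf.indicator measurableSet_Ici
    calc _ = ∫⁻ y : ℝ × Bool, (if y.2 = a then
          φ (τ + y.1) * ENNReal.ofReal (Real.exp (-(r * (t - (τ + y.1))))) else 0) ∂markLaw r := by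
          refine lintegral_congr fun y => ?_
          simp only [isRecord_update_cons, lastTime_update_cons, survival, arrivalTime_update_succ,
            hw, true_and, hφ, Set.indicator_apply, Set.mem_Ici]
          by_cases h₁ : lastTime ω w ≤ τ + y.1 <;> by_cases h₂ : y.2 = a <;> simp [τ, h₁, h₂]
      _ ≤ 2⁻¹ * (ENNReal.ofReal r * (∫⁻ u, φ u) * ENNReal.ofReal (Real.exp (-(r * (t - τ))))) := by
          rw [lintegral_markLaw_snd_eq hr a
            (f := fun x => φ (τ + x) * ENNReal.ofReal (Real.exp (-(r * (t - (τ + x))))))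
            (by fun_prop)]
          gcongr
          exact lintegral_expMeasure_mul_exp_le hr t τ hφm
      _ = _ := by
          rw [if_pos hw, hφ, lintegral_indicator measurableSet_Ici,
            ENNReal.ofReal_div_of_pos two_pos, ENNReal.ofReal_ofNat, survival, div_eq_mul_inv]
          ring
  · simp [isRecord_update_cons, hw]

theorem survivalIntegral_cons_le {r : ℝ} (hr : 0 < r) (t : ℝ) {B : Finset ℤ} {b : ℤ} (hb : b ∈ B)
    (a : Bool) (w : List (ℤ × Bool)) {f : ℝ → ENNReal} (hf : Measurable f) :
    survivalIntegral r t B ((b, a) :: w) f ≤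
      ENNReal.ofReal (r / 2) * survivalIntegral r t B w fun s => ∫⁻ u in Set.Ici s, f u := by
  classical
  set others : MarkSpace → ENNReal := fun ω => ∏ x ∈ B.erase b, survival r t ω x (markCount w x)
    with hothers
  calc _ = ∫⁻ ω, others ω *
        ((if IsRecord ω ((b, a) :: w) then f (lastTime ω ((b, a) :: w)) else 0) *
          survival r t ω b (markCount w b + 1)) ∂marksLaw r := by
        refine lintegral_congr fun ω => ?_
        rw [← Finset.mul_prod_erase _ _ hb, markCount_cons_self, ← mul_assoc, mul_comm]
        congr 1
        refine Finset.prod_congr rfl fun x hx => ?_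
        rw [markCount_cons_of_ne (Finset.ne_of_mem_erase hx)]
    _ ≤ ∫⁻ ω, others ω * (ENNReal.ofReal (r / 2) *
        (if IsRecord ω w then ∫⁻ u in Set.Ici (lastTime ω w), f u else 0) *
        survival r t ω b (markCount w b)) ∂marksLaw r := by
        refine lintegral_marksLaw_mul_le_of_resample hr (b, markCount w b) ?_ (fun ω y => ?_)
          fun ω => lintegral_next_mark_le hr t ω b a w hf
        · exact (Measurable.ite (measurableSet_isRecord _) (hf.comp (measurable_lastTime _))
            measurable_const).mul (measurable_survival r t b _)
        · refine Finset.prod_congr rfl fun x hx => survival_update_of_le r t ω y ?_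
          exact fun hxb => absurd hxb (Finset.ne_of_mem_erase hx)
    _ = _ := by
        rw [survivalIntegral, ← lintegral_const_mul' _ _ ENNReal.ofReal_ne_top]
        refine lintegral_congr fun ω => ?_
        rw [← Finset.mul_prod_erase _ _ hb, hothers]
        ring

/-- The volume of the set of ordered `j`-tuples of times in `[s, t]`. -/
noncomputable def simplexVolume (t : ℝ) (j : ℕ) (s : ℝ) : ENNReal :=
  if s ≤ t then ENNReal.ofReal ((t - s) ^ j / j.factorial) else 0

theorem measurable_simplexVolume (t : ℝ) (j : ℕ) : Measurable (simplexVolume t j) :=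
  Measurable.ite measurableSet_Iic (by fun_prop) measurable_const

theorem setLIntegral_Ici_simplexVolume (t : ℝ) (j : ℕ) (s : ℝ) :
    ∫⁻ u in Set.Ici s, simplexVolume t j u = simplexVolume t (j + 1) s := by
  have hind : (Set.Ici s).indicator (simplexVolume t j) =
      (Set.Icc s t).indicator fun u => ENNReal.ofReal ((t - u) ^ j / j.factorial) := by
    ext u
    by_cases hsu : s ≤ u <;> by_cases hut : u ≤ t <;> simp [Set.indicator, simplexVolume, hsu, hut]
  rw [← lintegral_indicator measurableSet_Ici, hind, lintegral_indicator measurableSet_Icc,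
    simplexVolume]
  split_ifs with hst
  · rw [← ofReal_integral_eq_lintegral_ofReal]
    · rw [integral_Icc_eq_integral_Ioc, ← intervalIntegral.integral_of_le hst,
        intervalIntegral.integral_div,
        intervalIntegral.integral_comp_sub_left (fun x => x ^ j) t, integral_pow, sub_self,
        zero_pow j.succ_ne_zero, sub_zero, div_div, Nat.factorial_succ]
      push_cast
      rfl
    · exact (by fun_prop : Continuous fun u : ℝ => (t - u) ^ j / j.factorial).integrableOn_Icc
    · refine (ae_restrict_iff' measurableSet_Icc).2 (Filter.Eventually.of_forall fun u hu => ?_)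
      exact div_nonneg (pow_nonneg (sub_nonneg.2 hu.2) j) (Nat.cast_nonneg _)
  · simp [Set.Icc_eq_empty hst]

theorem survivalIntegral_simplexVolume_le {r : ℝ} (hr : 0 < r) (t : ℝ) (B : Finset ℤ)
    (w : List (ℤ × Bool)) (hw : ∀ l ∈ w, l.1 ∈ B) (j : ℕ) :
    survivalIntegral r t B w (simplexVolume t j) ≤ ENNReal.ofReal (r / 2) ^ w.length *
      (ENNReal.ofReal (Real.exp (-(r * t))) ^ B.card * simplexVolume t (j + w.length) 0) := by
  have := isProbabilityMeasure_marksLaw hr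
  induction w generalizing j with
  | nil =>
    simp [survivalIntegral, IsRecord, lastTime, survival, arrivalTime, markCount, mul_comm]
  | cons l w ih =>
    refine (survivalIntegral_cons_le hr t (hw l List.mem_cons_self) l.2 w
      (measurable_simplexVolume t j)).trans ?_
    simp only [setLIntegral_Ici_simplexVolume]
    refine (mul_le_mul_right (ih (fun l hl => hw l (List.mem_cons_of_mem _ hl)) (j + 1)) _).trans_eq
      ?_
    rw [List.length_cons, pow_succ', mul_assoc, add_assoc, add_comm 1]

theorem marksLaw_isHistory_le {r : ℝ} (hr : 0 < r) {t : ℝ} (ht : 0 ≤ t) (B : Finset ℤ)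
    (w : List (ℤ × Bool)) (hw : ∀ l ∈ w, l.1 ∈ B) :
    marksLaw r {ω | IsHistory t B w ω} ≤ ENNReal.ofReal
      (Real.exp (-(B.card * (r * t))) * (r * t / 2) ^ w.length / w.length.factorial) := by
  classical
  have hindicator : {ω | IsHistory t B w ω}.indicator (1 : MarkSpace → ENNReal) = fun ω =>
      (if IsRecord ω w then simplexVolume t 0 (lastTime ω w) else 0) *
        ∏ b ∈ B, (if t < arrivalTime ω b (markCount w b + 1) then 1 else 0) := by
    ext ω
    rw [Finset.prod_ite_zero]
    by_cases hrec : IsRecord ω w <;> by_cases hlast : lastTime ω w ≤ t <;>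
      simp [Set.indicator_apply, IsHistory, simplexVolume, hrec, hlast]
  rw [← lintegral_indicator_one (measurableSet_isHistory t B w), hindicator]
  refine (lintegral_mul_prod_late_le hr t (markCount w) B fun b _ ω y => ?_).trans
    ((survivalIntegral_simplexVolume_le hr t B w hw 0).trans_eq ?_)
  · simp only [lastTime_update ω w le_rfl, isRecord_update ω w le_rfl]
  · rw [simplexVolume, if_pos ht, ← ENNReal.ofReal_pow (by positivity),
      ← ENNReal.ofReal_pow (by positivity), ← ENNReal.ofReal_mul (by positivity),
      ← ENNReal.ofReal_mul (by positivity), ← Real.exp_nat_mul]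
    congr 1
    rw [zero_add, sub_zero, mul_neg, div_pow, div_pow, mul_pow]
    ring

end Histories

section Chronology

/-- The list `P` of marks, the most recent one first, consists of the first marks of `ω` at each
pair of sites. -/
structure IsInitialSegment (ω : MarkSpace) (P : List (ℤ × ℕ)) : Prop where
  sorted : P.Pairwise fun p q => markTime ω q ≤ markTime ω p
  nodup : P.Nodup
  mem_of_lt : ∀ {b : ℤ} {i j : ℕ}, (b, i) ∈ P → j < i → (b, j) ∈ P

/-- The pairs of sites and the attributes of a list of marks given by their numbers. -/
def markList (ω : MarkSpace) (P : List (ℤ × ℕ)) : List (ℤ × Bool) := P.map fun p => (p.1, (ω p).2)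

variable {ω : MarkSpace}

theorem strictMono_markTime (hω : ∀ p, 0 < (ω p).1) (b : ℤ) :
    StrictMono fun i => markTime ω (b, i) :=
  strictMono_nat_of_lt_succ fun i => by
    simpa only [markTime_eq_arrivalTime, arrivalTime, Finset.sum_range_succ _ (i + 1)] using
      lt_add_of_pos_right _ (hω (b, i + 1))

theorem IsInitialSegment.tail (hω : ∀ p, 0 < (ω p).1) {p : ℤ × ℕ} {P : List (ℤ × ℕ)}
    (h : IsInitialSegment ω (p :: P)) : IsInitialSegment ω P where
  sorted := h.sorted.of_cons
  nodup := h.nodup.of_cons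
  mem_of_lt {b i j} hi hj := by
    refine (List.mem_cons.1 (h.mem_of_lt (List.mem_cons_of_mem p hi) hj)).resolve_left ?_
    rintro rfl
    exact (List.rel_of_pairwise_cons h.sorted hi).not_gt (strictMono_markTime hω b hj)

theorem IsInitialSegment.mem_iff (hω : ∀ p, 0 < (ω p).1) {P : List (ℤ × ℕ)}
    (h : IsInitialSegment ω P) (b : ℤ) (i : ℕ) :
    (b, i) ∈ P ↔ i < markCount (markList ω P) b := by
  induction P generalizing i with
  | nil => simp [markList, markCount]
  | cons p P ih =>
    obtain ⟨b', i'⟩ := p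
    have ih := ih (h.tail hω)
    rw [markList, List.map_cons, ← markList]
    obtain rfl | hb := eq_or_ne b b'
    · have hi' : i' = markCount (markList ω P) b := by
        refine le_antisymm (not_lt.1 fun hlt => ?_) (not_lt.1 fun hlt => ?_)
        · have hmem := h.mem_of_lt List.mem_cons_self hlt
          simp only [List.mem_cons, Prod.mk.injEq, true_and, ih, lt_irrefl, or_false] at hmem
          exact hlt.ne hmem
        · exact h.nodup.notMem ((ih i').2 hlt)
      rw [List.mem_cons, ih, markCount_cons_self, Prod.mk.injEq, hi', Nat.lt_succ_iff_lt_or_eq,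
        or_comm]
      simp
    · rw [List.mem_cons, ih, markCount_cons_of_ne hb]
      simp [hb]

theorem IsInitialSegment.markCount_tail (hω : ∀ p, 0 < (ω p).1) {b : ℤ} {i : ℕ}
    {P : List (ℤ × ℕ)} (h : IsInitialSegment ω ((b, i) :: P)) :
    markCount (markList ω P) b = i := by
  have hlt : i < markCount (markList ω P) b + 1 := by
    simpa only [markList, List.map_cons, markCount_cons_self] using
      (h.mem_iff hω b i).1 List.mem_cons_self
  have hnot : ¬ i < markCount (markList ω P) b := fun hi =>
    h.nodup.notMem (((h.tail hω).mem_iff hω b i).2 hi)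
  omega

theorem IsInitialSegment.lastTime_eq (hω : ∀ p, 0 < (ω p).1) {p : ℤ × ℕ} {P : List (ℤ × ℕ)}
    (h : IsInitialSegment ω (p :: P)) : lastTime ω (markList ω (p :: P)) = markTime ω p := by
  rw [markList, List.map_cons, ← markList, lastTime, h.markCount_tail hω, markTime_eq_arrivalTime]

theorem IsInitialSegment.lastTime_le (hω : ∀ p, 0 < (ω p).1) {P : List (ℤ × ℕ)}
    (h : IsInitialSegment ω P) {t : ℝ} (ht : 0 ≤ t) (hP : ∀ p ∈ P, markTime ω p ≤ t) :
    lastTime ω (markList ω P) ≤ t := by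
  cases P with
  | nil => exact ht
  | cons p P => exact (h.lastTime_eq hω).trans_le (hP p List.mem_cons_self)

theorem IsInitialSegment.isRecord (hω : ∀ p, 0 < (ω p).1) {P : List (ℤ × ℕ)}
    (h : IsInitialSegment ω P) : IsRecord ω (markList ω P) := by
  induction P with
  | nil => trivial
  | cons p P ih =>
    refine ⟨ih (h.tail hω), ?_, ?_⟩
    · refine ((h.tail hω).lastTime_le hω ?_ fun q hq => List.rel_of_pairwise_cons h.sorted hq).trans
        (h.lastTime_eq hω).ge
      exact Finset.sum_nonneg fun i _ => (hω _).le
    · exact congrArg (fun k => (ω (p.1, k)).2) (h.markCount_tail hω)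

/-- The pairs of sites `{b, b + 1}` that intersect `Λ_N`. -/
noncomputable def bonds (N : ℕ) : Finset ℤ := Finset.Icc (-(N : ℤ) - 1) N

theorem mem_marksUpTo_iff {N : ℕ} {t : ℝ} {p : ℤ × ℕ} :
    p ∈ marksUpTo N ω t ↔ p.1 ∈ bonds N ∧ markTime ω p ≤ t := by
  rw [marksUpTo, Set.mem_ofPred_eq, bonds, Finset.mem_Icc, and_assoc]

theorem exists_isInitialSegment_chronologicalMarks (hω : ∀ p, 0 < (ω p).1) {N : ℕ} {t : ℝ}
    (hfin : (marksUpTo N ω t).Finite) :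
    ∃ P, IsInitialSegment ω P ∧ (∀ p, p ∈ P ↔ p.1 ∈ bonds N ∧ markTime ω p ≤ t) ∧
      (chronologicalMarks N ω t).reverse = markList ω P := by
  classical
  set L := hfin.toFinset.toList.mergeSort fun p q => decide (markTime ω p ≤ markTime ω q)
  have hmem : ∀ p, p ∈ L.reverse ↔ p.1 ∈ bonds N ∧ markTime ω p ≤ t := fun p => by
    rw [List.mem_reverse, List.mem_mergeSort, Finset.mem_toList, Set.Finite.mem_toFinset,
      mem_marksUpTo_iff]
  have hsorted : L.Pairwise fun p q => markTime ω p ≤ markTime ω q := by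
    simpa only [decide_eq_true_eq] using
      List.pairwise_mergeSort (le := fun p q => decide (markTime ω p ≤ markTime ω q))
        (fun _ _ _ => by simpa only [decide_eq_true_eq] using le_trans)
        (fun _ _ => by simpa only [Bool.or_eq_true, decide_eq_true_eq] using le_total _ _)
        hfin.toFinset.toList
  refine ⟨L.reverse, ⟨List.pairwise_reverse.2 hsorted, List.nodup_reverse.2 ?_, ?_⟩, hmem, ?_⟩
  · exact (List.mergeSort_perm _ _).nodup_iff.2 (Finset.nodup_toList _)
  · intro b i j hi hj
    rw [hmem] at hi ⊢
    exact ⟨hi.1, (strictMono_markTime hω b hj).le.trans hi.2⟩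
  · rw [chronologicalMarks, dif_pos hfin, ← List.map_reverse]
    rfl

theorem isHistory_chronologicalMarks (hω : ∀ p, 0 < (ω p).1) {N : ℕ} {t : ℝ} (ht : 0 ≤ t)
    (hfin : (marksUpTo N ω t).Finite) :
    IsHistory t (bonds N) (chronologicalMarks N ω t).reverse ω := by
  obtain ⟨P, hP, hmem, hrev⟩ := exists_isInitialSegment_chronologicalMarks hω hfin
  rw [hrev]
  refine ⟨hP.isRecord hω, hP.lastTime_le hω ht fun p hp => ((hmem p).1 hp).2, fun b hb => ?_⟩
  by_contra! hle
  exact lt_irrefl _ ((hP.mem_iff hω b _).1 ((hmem (b, _)).2 ⟨hb, hle⟩))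

theorem fst_mem_bonds_of_mem_chronologicalMarks {N : ℕ} {t : ℝ} {l : ℤ × Bool}
    (hl : l ∈ chronologicalMarks N ω t) : l.1 ∈ bonds N := by
  rw [chronologicalMarks] at hl
  split_ifs at hl with hfin
  · obtain ⟨p, hp, rfl⟩ := List.mem_map.1 hl
    rw [List.mem_mergeSort, Finset.mem_toList, Set.Finite.mem_toFinset] at hp
    exact (mem_marksUpTo_iff.1 hp).1
  · exact absurd hl List.not_mem_nil

/-- The realizations of the marks with positive waiting times and finitely many marks up to
time `t` near `Λ_N`. -/
def regularMarks (N : ℕ) (t : ℝ) : Set MarkSpace :=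
  {ω | (∀ p, 0 < (ω p).1) ∧ (marksUpTo N ω t).Finite}

theorem marksLaw_chronologicalMarks_eq_le {r : ℝ} (hr : 0 < r) {t : ℝ} (ht : 0 ≤ t) (N : ℕ)
    {w : List (ℤ × Bool)} (hw : ∀ l ∈ w, l.1 ∈ bonds N) :
    marksLaw r (regularMarks N t ∩ {ω | chronologicalMarks N ω t = w}) ≤ ENNReal.ofReal
      (Real.exp (-((bonds N).card * (r * t))) * (r * t / 2) ^ w.length / w.length.factorial) := by
  have hhistory := marksLaw_isHistory_le hr ht (bonds N) w.reverse (by simpa using hw)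
  rw [List.length_reverse] at hhistory
  refine (measure_mono ?_).trans hhistory
  rintro ω ⟨⟨hω, hfin⟩, rfl⟩
  exact isHistory_chronologicalMarks hω ht hfin

end Chronology

section PoissonWords

variable {α : Type*}

/-- The lists of `m` letters of the alphabet `A`. -/
def words (A : Finset α) : ℕ → Finset (List α)
  | 0 => {[]}
  | m + 1 => (A ×ˢ words A m).map
      ⟨fun p => p.1 :: p.2, fun _ _ h => Prod.ext (List.cons.inj h).1 (List.cons.inj h).2⟩

theorem mem_words {A : Finset α} {m : ℕ} {w : List α} :
    w ∈ words A m ↔ w.length = m ∧ ∀ l ∈ w, l ∈ A := by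
  induction m generalizing w with
  | zero => cases w <;> simp [words]
  | succ m ih =>
    cases w with
    | nil => simp [words]
    | cons l w =>
      have hmem : l :: w ∈ words A (m + 1) ↔ l ∈ A ∧ w ∈ words A m :=
        (Finset.mem_map' (a := (l, w)) _).trans Finset.mem_product
      simp [hmem, ih, and_left_comm]

theorem sum_words_succ (A : Finset α) (m : ℕ) (F : List α → ℝ) :
    ∑ w ∈ words A (m + 1), F w = ∑ l ∈ A, ∑ w ∈ words A m, F (l :: w) := by
  rw [words, Finset.sum_map, Finset.sum_product]
  rfl

variable {S Ω : Type*} {A : Finset α} {step : S → α → S} {I : S → Prop} {F : S → ℝ} {κ : ℝ}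

theorem sum_words_foldl_le (hI : ∀ s l, I s → I (step s l)) (hκ : 0 ≤ κ)
    (hF : ∀ s, I s → ∑ l ∈ A, (F (step s l) - F s) ≤ κ * F s) (m : ℕ) {s : S} (hs : I s) :
    ∑ w ∈ words A m, F (w.foldl step s) ≤ (A.card + κ) ^ m * F s := by
  induction m generalizing s with
  | zero => simp [words]
  | succ m ih =>
    have hstep : ∑ l ∈ A, F (step s l) ≤ (A.card + κ) * F s := by
      have := hF s hs
      rw [Finset.sum_sub_distrib, Finset.sum_const, nsmul_eq_mul] at this
      linarith
    calc _ = ∑ l ∈ A, ∑ w ∈ words A m, F (w.foldl step (step s l)) := sum_words_succ A m _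
      _ ≤ ∑ l ∈ A, (A.card + κ) ^ m * F (step s l) :=
          Finset.sum_le_sum fun l _ => ih (hI s l hs)
      _ = (A.card + κ) ^ m * ∑ l ∈ A, F (step s l) := by rw [Finset.mul_sum]
      _ ≤ (A.card + κ) ^ m * ((A.card + κ) * F s) := by gcongr
      _ = _ := by ring

variable [MeasurableSpace Ω] {μ : Measure Ω} {E : Set Ω} {X : Ω → List α} {θ : ℝ} {s₀ : S}

theorem measure_foldl_length_eq_le (hX : ∀ ω ∈ E, ∀ l ∈ X ω, l ∈ A)
    (hI : ∀ s l, I s → I (step s l)) (hF₀ : ∀ s, 0 ≤ F s) (hκ : 0 ≤ κ)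
    (hF : ∀ s, I s → ∑ l ∈ A, (F (step s l) - F s) ≤ κ * F s) (hs₀ : I s₀) (hθ : 0 < θ)
    {m : ℕ} {q : ℝ} (hq : 0 ≤ q)
    (hμ : ∀ w ∈ words A m, μ (E ∩ {ω | X ω = w}) ≤ ENNReal.ofReal q) :
    μ (E ∩ {ω | θ ≤ F ((X ω).foldl step s₀) ∧ (X ω).length = m}) ≤
      ENNReal.ofReal (q * ((A.card + κ) ^ m * F s₀ / θ)) := by
  classical
  set W := (words A m).filter fun w => θ ≤ F (w.foldl step s₀)
  calc _ ≤ μ (⋃ w ∈ W, E ∩ {ω | X ω = w}) := by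
        refine measure_mono ?_
        rintro ω ⟨hω, hle, hlength⟩
        exact Set.mem_biUnion (x := X ω)
          (Finset.mem_filter.2 ⟨mem_words.2 ⟨hlength, hX ω hω⟩, hle⟩) ⟨hω, rfl⟩
    _ ≤ ∑ w ∈ W, μ (E ∩ {ω | X ω = w}) := measure_biUnion_finset_le _ _
    _ ≤ ∑ w ∈ W, ENNReal.ofReal (q * (F (w.foldl step s₀) / θ)) := by
        refine Finset.sum_le_sum fun w hw => ?_
        obtain ⟨hword, hle⟩ := Finset.mem_filter.1 hw
        exact (hμ w hword).trans (ENNReal.ofReal_le_ofReal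
          (le_mul_of_one_le_right hq ((one_le_div hθ).2 hle)))
    _ = ENNReal.ofReal (q * ((∑ w ∈ W, F (w.foldl step s₀)) / θ)) := by
        rw [← ENNReal.ofReal_sum_of_nonneg fun w _ => mul_nonneg hq (div_nonneg (hF₀ _) hθ.le),
          Finset.sum_div, Finset.mul_sum]
    _ ≤ ENNReal.ofReal (q * ((A.card + κ) ^ m * F s₀ / θ)) := by
        gcongr
        exact (Finset.sum_le_sum_of_subset_of_nonneg (Finset.filter_subset _ _)
          fun w _ _ => hF₀ _).trans (sum_words_foldl_le hI hκ hF m hs₀)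

theorem measure_le_foldl_le (hX : ∀ ω ∈ E, ∀ l ∈ X ω, l ∈ A)
    (hI : ∀ s l, I s → I (step s l)) (hF₀ : ∀ s, 0 ≤ F s) (hκ : 0 ≤ κ)
    (hF : ∀ s, I s → ∑ l ∈ A, (F (step s l) - F s) ≤ κ * F s) (hs₀ : I s₀) (hθ : 0 < θ)
    {ρ : ℝ} (hρ : 0 ≤ ρ)
    (hμ : ∀ w, (∀ l ∈ w, l ∈ A) → μ (E ∩ {ω | X ω = w}) ≤
      ENNReal.ofReal (Real.exp (-(A.card * ρ)) * ρ ^ w.length / w.length.factorial)) :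
    μ (E ∩ {ω | θ ≤ F ((X ω).foldl step s₀)}) ≤
      ENNReal.ofReal (Real.exp (κ * ρ) * F s₀ / θ) := by
  set q : ℕ → ℝ := fun m => Real.exp (-(A.card * ρ)) * ρ ^ m / m.factorial with hq
  have hq₀ : ∀ m, 0 ≤ q m := fun m => by positivity
  have hsum : HasSum (fun m => q m * ((A.card + κ) ^ m * F s₀ / θ))
      (Real.exp (κ * ρ) * F s₀ / θ) := by
    have hexp := ((Real.exp_eq_exp_ℝ ▸ NormedSpace.expSeries_div_hasSum_exp
      (ρ * (A.card + κ))).mul_left (Real.exp (-(A.card * ρ)))).mul_right (F s₀ / θ)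
    convert! hexp using 1
    · ext m
      rw [hq, mul_pow]
      ring
    · rw [← Real.exp_add, ← mul_div_assoc]
      ring_nf
  calc _ ≤ μ (⋃ m, E ∩ {ω | θ ≤ F ((X ω).foldl step s₀) ∧ (X ω).length = m}) := by
        refine measure_mono ?_
        rintro ω ⟨hω, hle⟩
        exact Set.mem_iUnion.2 ⟨_, hω, hle, rfl⟩
    _ ≤ ∑' m, ENNReal.ofReal (q m * ((A.card + κ) ^ m * F s₀ / θ)) := by
        refine (measure_iUnion_le _).trans (ENNReal.tsum_le_tsum fun m =>
          measure_foldl_length_eq_le hX hI hF₀ hκ hF hs₀ hθ (hq₀ m) fun w hw => ?_)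
        obtain ⟨rfl, hletters⟩ := mem_words.1 hw
        exact hμ w hletters
    _ = _ := by
        rw [← ENNReal.ofReal_tsum_of_nonneg (fun m => mul_nonneg (hq₀ m) ?_) hsum.summable,
          hsum.tsum_eq]
        exact div_nonneg (mul_nonneg (by positivity) (hF₀ _)) hθ.le

end PoissonWords

/-- The possible marks at the pairs of sites that intersect `Λ_N`. -/
noncomputable def letters (N : ℕ) : Finset (ℤ × Bool) := bonds N ×ˢ Finset.univ

theorem mem_letters {N : ℕ} {l : ℤ × Bool} : l ∈ letters N ↔ l.1 ∈ bonds N := by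
  simp [letters]

theorem sum_letters (N : ℕ) (f : ℤ × Bool → ℝ) :
    ∑ l ∈ letters N, f l = ∑ b ∈ bonds N, (f (b, true) + f (b, false)) := by
  simp [letters, Finset.sum_product]

theorem marksLaw_le_foldl_chronologicalMarks_le {S : Type*} {r : ℝ} (hr : 0 < r) {t : ℝ}
    (ht : 0 ≤ t) (N : ℕ) {step : S → ℤ × Bool → S} {I : S → Prop}
    (hI : ∀ s l, I s → I (step s l)) {F : S → ℝ} (hF₀ : ∀ s, 0 ≤ F s) {κ : ℝ} (hκ : 0 ≤ κ)
    (hF : ∀ s, I s → ∑ l ∈ letters N, (F (step s l) - F s) ≤ 2 * κ * F s) {s₀ : S} (hs₀ : I s₀)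
    {θ : ℝ} (hθ : 0 < θ) :
    marksLaw r (regularMarks N t ∩ {ω | θ ≤ F ((chronologicalMarks N ω t).foldl step s₀)}) ≤
      ENNReal.ofReal (Real.exp (κ * (r * t)) * F s₀ / θ) := by
  have hcard : (letters N).card = 2 * ((bonds N).card : ℝ) := by
    simp [letters, mul_comm]
  refine (measure_le_foldl_le (A := letters N) (ρ := r * t / 2)
    (fun ω _ l hl => mem_letters.2 (fst_mem_bonds_of_mem_chronologicalMarks hl)) hI hF₀
    (by positivity) hF hs₀ hθ (by positivity) fun w hw => ?_).trans_eq ?_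
  · refine (marksLaw_chronologicalMarks_eq_le hr ht N fun l hl => mem_letters.1 (hw l hl)).trans_eq
      ?_
    rw [hcard]
    ring_nf
  · ring_nf

/-! ### Symmetric exclusion on a segment -/

/-- The site `p` belongs to `Λ_N`. -/
def InBox (N : ℕ) (p : ℤ) : Prop := -(N : ℤ) ≤ p ∧ p ≤ N

/-- The nearest site of `Λ_N`. Suppressing the jumps out of `Λ_N` amounts to composing them with
this projection. -/
def clamp (N : ℕ) (p : ℤ) : ℤ := max (-N) (min p N)

/-- The displacement that takes `b` and `b + 1` to each other and fixes the other sites. -/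
def jump (b p : ℤ) : ℤ := if p = b then 1 else if p = b + 1 then -1 else 0

/-- The new position of a particle at `p` when the contents of `b` and `b + 1` are exchanged; the
exchange takes place only if both sites belong to `Λ_N`. -/
def exchange (N : ℕ) (b p : ℤ) : ℤ :=
  if -(N : ℤ) ≤ b ∧ b + 1 ≤ N then Equiv.swap b (b + 1) p else p

theorem inBox_clamp (N : ℕ) (p : ℤ) : InBox N (clamp N p) := by
  unfold InBox clamp
  omega

theorem clamp_eq_self {N : ℕ} {p : ℤ} (hp : InBox N p) : clamp N p = p := by
  unfold InBox at hp
  unfold clamp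
  omega

theorem abs_clamp_sub_clamp_le (N : ℕ) (p q : ℤ) : |clamp N p - clamp N q| ≤ |p - q| := by
  unfold clamp
  grind

theorem clamp_add_one {N : ℕ} {p : ℤ} (hp : InBox N p) :
    clamp N (p + 1) = p + 1 - if p = N then 1 else 0 := by
  unfold InBox at hp
  unfold clamp
  omega

theorem clamp_sub_one {N : ℕ} {p : ℤ} (hp : InBox N p) :
    clamp N (p - 1) = p - 1 + if p = -N then 1 else 0 := by
  unfold InBox at hp
  unfold clamp
  omega

theorem exchange_injective (N : ℕ) (b : ℤ) : Function.Injective (exchange N b) := by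
  unfold exchange
  split_ifs
  · exact (Equiv.swap b (b + 1)).injective
  · exact Function.injective_id

theorem exchange_eq_clamp {N : ℕ} {p : ℤ} (hp : InBox N p) (b : ℤ) :
    exchange N b p = clamp N (p + jump b p) := by
  unfold InBox at hp
  unfold exchange clamp jump
  grind

theorem InBox.exchange {N : ℕ} {p : ℤ} (hp : InBox N p) (b : ℤ) :
    InBox N (_root_.exchange N b p) :=
  exchange_eq_clamp hp b ▸ inBox_clamp N _

theorem abs_jump_le_one (b p : ℤ) : |jump b p| ≤ 1 := by
  unfold jump
  split_ifs <;> simp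

theorem abs_exchange_sub_le_one {N : ℕ} {p : ℤ} (hp : InBox N p) (b : ℤ) :
    |exchange N b p - p| ≤ 1 := by
  calc |exchange N b p - p| = |clamp N (p + jump b p) - clamp N p| := by
        rw [exchange_eq_clamp hp, clamp_eq_self hp]
    _ ≤ |p + jump b p - p| := abs_clamp_sub_clamp_le N _ _
    _ ≤ 1 := by
        rw [add_sub_cancel_left]
        exact abs_jump_le_one b p

theorem sum_exchange_sub {M : Type*} [AddCommGroup M] {N : ℕ} {p : ℤ} (hp : InBox N p)
    (f : ℤ → M) :
    ∑ b ∈ bonds N, (f (exchange N b p) - f p)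
      = (f (clamp N (p + 1)) - f p) + (f (clamp N (p - 1)) - f p) := by
  have hbond : ∀ b, f (exchange N b p) - f p = (if b = p then f (clamp N (p + 1)) - f p else 0)
      + (if b = p - 1 then f (clamp N (p - 1)) - f p else 0) := by
    intro b
    rw [exchange_eq_clamp hp, jump]
    by_cases h₁ : b = p
    · simp [h₁, show p ≠ p - 1 by omega]
    by_cases h₂ : b = p - 1
    · simp [h₂, sub_eq_add_neg]
    rw [if_neg (by omega), if_neg (by omega)]
    simp [h₁, h₂, clamp_eq_self hp]
  have hmem : p ∈ bonds N ∧ p - 1 ∈ bonds N := by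
    unfold InBox at hp
    simp only [bonds, Finset.mem_Icc]
    omega
  simp only [hbond, Finset.sum_add_distrib, Finset.sum_ite_eq', hmem.1, hmem.2, if_true]

theorem sum_abs_exchange_sub_le {N : ℕ} {p : ℤ} (hp : InBox N p) :
    ∑ b ∈ bonds N, |exchange N b p - p| ≤ 2 := by
  have h := sum_exchange_sub hp fun q => |q - p|
  simp only [sub_self, abs_zero, sub_zero] at h
  rw [h]
  have hclamp : ∀ d, |clamp N (p + d) - p| ≤ |d| := fun d => by
    simpa [clamp_eq_self hp] using abs_clamp_sub_clamp_le N (p + d) p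
  simpa [sub_eq_add_neg] using add_le_add (hclamp 1) (hclamp (-1))

theorem sum_exchange_sq_sub_le {N : ℕ} {p : ℤ} (hp : InBox N p) :
    ∑ b ∈ bonds N, (exchange N b p ^ 2 - p ^ 2) ≤ 2 - if |p| = N then 2 * (N : ℤ) else 0 := by
  rw [sum_exchange_sub hp fun q => q ^ 2, clamp_add_one hp, clamp_sub_one hp]
  have : |p| = N ↔ p = N ∨ p = -N := abs_eq (Nat.cast_nonneg N)
  split_ifs <;> grind

theorem abs_exchange_sub_exchange {N : ℕ} {p q : ℤ} (hp : InBox N p) (hq : InBox N q)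
    (hpq : p < q) (b : ℤ) :
    |exchange N b p - exchange N b q|
      = exchange N b q - exchange N b p + if b = p then if q = p + 1 then 2 else 0 else 0 := by
  unfold InBox at hp hq
  unfold exchange
  grind

theorem le_sum_abs_exchange_sub_of_lt {N : ℕ} {p q : ℤ} (hp : InBox N p) (hq : InBox N q)
    (hpq : p < q) :
    (if q = p + 1 then 2 else 0) - (if |p| = N then 1 else 0) - (if |q| = N then 1 else 0)
      ≤ ∑ b ∈ bonds N, (|exchange N b p - exchange N b q| - |p - q|) := by
  have hsplit : ∀ b, |exchange N b p - exchange N b q| - |p - q|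
      = (exchange N b q - q) - (exchange N b p - p)
        + if b = p then if q = p + 1 then 2 else 0 else 0 := by
    intro b
    rw [abs_exchange_sub_exchange hp hq hpq, abs_of_neg (by omega : p - q < 0)]
    ring
  have hmem : p ∈ bonds N := by
    unfold InBox at hp
    simp only [bonds, Finset.mem_Icc]
    omega
  simp only [hsplit, Finset.sum_add_distrib, Finset.sum_sub_distrib, Finset.sum_ite_eq', hmem,
    if_true]
  rw [← Finset.sum_sub_distrib, ← Finset.sum_sub_distrib, sum_exchange_sub hp fun r => r,
    sum_exchange_sub hq fun r => r, clamp_add_one hp, clamp_add_one hq, clamp_sub_one hp,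
    clamp_sub_one hq]
  grind

theorem le_sum_abs_exchange_sub {N : ℕ} {p q : ℤ} (hp : InBox N p) (hq : InBox N q) :
    (if q = p + 1 then 2 else 0) - (if |p| = N then 1 else 0) - (if |q| = N then 1 else 0)
      ≤ ∑ b ∈ bonds N, (|exchange N b p - exchange N b q| - |p - q|) := by
  rcases lt_trichotomy p q with h | rfl | h
  · exact le_sum_abs_exchange_sub_of_lt hp hq h
  · simp only [sub_self, abs_zero, Finset.sum_const_zero]
    grind
  · have := le_sum_abs_exchange_sub_of_lt hq hp h
    simp only [abs_sub_comm (exchange N _ q), abs_sub_comm q p] at this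
    grind

/-! ### The potential -/

/-- Potential of a pair of particles. The sum over the bonds of its increments under an exchange
is at least twice the indicator of `q = p + 1`, up to an error `4 / N`: the quadratic term
compensates the attraction of the boundary of `Λ_N`. -/
noncomputable def pairPotential (N : ℕ) (p q : ℤ) : ℝ :=
  |(p : ℝ) - q| - ((p : ℝ) ^ 2 + (q : ℝ) ^ 2) / N

/-- Sum of the potentials of all ordered pairs of particles. -/
noncomputable def potential (N : ℕ) {ι : Type*} [Fintype ι] (x : ι → ℤ) : ℝ :=
  ∑ i, ∑ j, pairPotential N (x i) (x j)

/-- Number of pairs of neighbouring particles. -/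
noncomputable def adjacentPairs {ι : Type*} [Fintype ι] (x : ι → ℤ) : ℝ :=
  ∑ i, ∑ j, if x j = x i + 1 then 1 else 0

theorem sum_exchange_sq_sub_div_le {N : ℕ} (hN : 0 < N) {p : ℤ} (hp : InBox N p) :
    (∑ b ∈ bonds N, ((exchange N b p : ℝ) ^ 2 - (p : ℝ) ^ 2)) / N
      ≤ 2 / N - 2 * if |p| = N then 1 else 0 := by
  have hN' : (0 : ℝ) < N := by exact_mod_cast hN
  have h := (Int.cast_le (R := ℝ)).2 (sum_exchange_sq_sub_le hp)
  push_cast at h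
  rw [div_le_iff₀ hN']
  refine h.trans_eq ?_
  split_ifs
  · field_simp
  · simp [hN'.ne']

theorem le_sum_pairPotential_exchange_sub {N : ℕ} (hN : 0 < N) {p q : ℤ} (hp : InBox N p)
    (hq : InBox N q) :
    2 * (if q = p + 1 then (1 : ℝ) else 0) - 4 / N
      ≤ ∑ b ∈ bonds N,
          (pairPotential N (exchange N b p) (exchange N b q) - pairPotential N p q) := by
  have hsplit : ∑ b ∈ bonds N, (pairPotential N (exchange N b p) (exchange N b q)
      - pairPotential N p q)
      = ∑ b ∈ bonds N, (|(exchange N b p : ℝ) - exchange N b q| - |(p : ℝ) - q|)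
        - (∑ b ∈ bonds N, ((exchange N b p : ℝ) ^ 2 - (p : ℝ) ^ 2)) / N
        - (∑ b ∈ bonds N, ((exchange N b q : ℝ) ^ 2 - (q : ℝ) ^ 2)) / N := by
    simp only [Finset.sum_div, ← Finset.sum_sub_distrib, pairPotential]
    refine Finset.sum_congr rfl fun b _ => ?_
    ring
  have hdist := (Int.cast_le (R := ℝ)).2 (le_sum_abs_exchange_sub hp hq)
  push_cast at hdist
  have hsq := add_le_add (sum_exchange_sq_sub_div_le hN hp) (sum_exchange_sq_sub_div_le hN hq)
  have hnonneg : ∀ r : ℤ, (0 : ℝ) ≤ if |r| = N then 1 else 0 := fun r => by positivity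
  have htwo : (if q = p + 1 then (2 : ℝ) else 0) = 2 * if q = p + 1 then 1 else 0 := by simp
  rw [hsplit]
  linear_combination hdist + hsq + hnonneg p + hnonneg q - htwo

theorem abs_sq_sub_sq_div_le {N : ℕ} {p p' : ℤ} (hp : InBox N p) (hp' : InBox N p') :
    |((p' : ℝ) ^ 2 - (p : ℝ) ^ 2) / N| ≤ 2 * |(p' : ℝ) - p| := by
  have hcast : ∀ {r : ℤ}, InBox N r → |(r : ℝ)| ≤ N := fun h =>
    abs_le.2 ⟨by exact_mod_cast h.1, by exact_mod_cast h.2⟩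
  have hadd : |(p' : ℝ) + p| ≤ 2 * N :=
    (abs_add_le _ _).trans (by linarith [hcast hp, hcast hp'])
  rw [sq_sub_sq, abs_div, abs_mul, Nat.abs_cast]
  refine div_le_of_le_mul₀ (Nat.cast_nonneg N) (by positivity) ?_
  calc |(p' : ℝ) + p| * |(p' : ℝ) - p| ≤ 2 * N * |(p' : ℝ) - p| := by gcongr
    _ = 2 * |(p' : ℝ) - p| * N := by ring

theorem abs_pairPotential_sub_le {N : ℕ} {p q p' q' : ℤ} (hp : InBox N p) (hq : InBox N q)
    (hp' : InBox N p') (hq' : InBox N q') :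
    |pairPotential N p' q' - pairPotential N p q| ≤ 3 * |(p' : ℝ) - p| + 3 * |(q' : ℝ) - q| := by
  have hsplit : pairPotential N p' q' - pairPotential N p q = (|(p' : ℝ) - q'| - |(p : ℝ) - q|)
      - ((p' : ℝ) ^ 2 - (p : ℝ) ^ 2) / N - ((q' : ℝ) ^ 2 - (q : ℝ) ^ 2) / N := by
    unfold pairPotential
    ring
  have hdist : |(|(p' : ℝ) - q'| - |(p : ℝ) - q|)| ≤ |(p' : ℝ) - p| + |(q' : ℝ) - q| := by
    refine (abs_abs_sub_abs_le_abs_sub _ _).trans ?_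
    rw [sub_sub_sub_comm]
    exact abs_sub _ _
  rw [hsplit]
  refine ((abs_sub _ _).trans (add_le_add_left (abs_sub _ _) _)).trans ?_
  linarith [abs_sq_sub_sq_div_le hp hp', abs_sq_sub_sq_div_le hq hq']

section Potential

variable {N : ℕ} {ι : Type*} [Fintype ι] {x y : ι → ℤ}

theorem potential_comp_perm (N : ℕ) (x : ι → ℤ) (e : Equiv.Perm ι) :
    potential N (fun i => x (e i)) = potential N x := by
  unfold potential
  rw [← Equiv.sum_comp e (fun i => ∑ j, pairPotential N (x i) (x j))]
  exact Finset.sum_congr rfl fun i _ =>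
    Equiv.sum_comp e fun j => pairPotential N (x (e i)) (x j)

theorem abs_potential_sub_le (hx : ∀ i, InBox N (x i)) (hy : ∀ i, InBox N (y i)) :
    |potential N y - potential N x| ≤ 6 * Fintype.card ι * ∑ i, |(y i : ℝ) - x i| := by
  simp only [potential, ← Finset.sum_sub_distrib]
  calc _ ≤ ∑ i, ∑ j, |pairPotential N (y i) (y j) - pairPotential N (x i) (x j)| :=
        (Finset.abs_sum_le_sum_abs _ _).trans
          (Finset.sum_le_sum fun i _ => Finset.abs_sum_le_sum_abs _ _)
    _ ≤ ∑ i, ∑ j, (3 * |(y i : ℝ) - x i| + 3 * |(y j : ℝ) - x j|) :=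
        Finset.sum_le_sum fun i _ => Finset.sum_le_sum fun j _ =>
          abs_pairPotential_sub_le (hx i) (hx j) (hy i) (hy j)
    _ = _ := by
        simp only [Finset.sum_add_distrib, Finset.sum_const, Finset.card_univ, nsmul_eq_mul,
          ← Finset.mul_sum]
        ring

theorem le_sum_potential_exchange_sub (hN : 0 < N) (hx : ∀ i, InBox N (x i)) :
    2 * adjacentPairs x - 4 * (Fintype.card ι : ℝ) ^ 2 / N
      ≤ ∑ b ∈ bonds N, (potential N (fun i => exchange N b (x i)) - potential N x) := by
  calc 2 * adjacentPairs x - 4 * (Fintype.card ι : ℝ) ^ 2 / N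
      = ∑ i, ∑ j, (2 * (if x j = x i + 1 then (1 : ℝ) else 0) - 4 / N) := by
        simp only [adjacentPairs, Finset.sum_sub_distrib, Finset.sum_const, Finset.card_univ,
          nsmul_eq_mul, ← Finset.mul_sum]
        ring
    _ ≤ ∑ i, ∑ j, ∑ b ∈ bonds N, (pairPotential N (exchange N b (x i)) (exchange N b (x j))
          - pairPotential N (x i) (x j)) :=
        Finset.sum_le_sum fun i _ => Finset.sum_le_sum fun j _ =>
          le_sum_pairPotential_exchange_sub hN (hx i) (hx j)
    _ = _ := by
        simp only [potential, ← Finset.sum_sub_distrib]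
        rw [Finset.sum_comm (s := bonds N)]
        exact Finset.sum_congr rfl fun i _ => Finset.sum_comm

theorem abs_potential_exchange_sub_le (hx : ∀ i, InBox N (x i)) (b : ℤ) :
    |potential N (fun i => exchange N b (x i)) - potential N x|
      ≤ 6 * (Fintype.card ι : ℝ) ^ 2 := by
  have hone : ∀ i ∈ Finset.univ, |(exchange N b (x i) : ℝ) - x i| ≤ 1 := fun i _ => by
    exact_mod_cast abs_exchange_sub_le_one (hx i) b
  calc _ ≤ 6 * Fintype.card ι * ∑ i, |(exchange N b (x i) : ℝ) - x i| :=
        abs_potential_sub_le hx fun i => (hx i).exchange b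
    _ ≤ 6 * Fintype.card ι * ∑ _i : ι, (1 : ℝ) := by
        gcongr with i hi
        exact hone i hi
    _ = 6 * (Fintype.card ι : ℝ) ^ 2 := by
        rw [Finset.sum_const, Finset.card_univ, nsmul_eq_mul]
        ring

theorem sum_potential_exchange_sub_sq_le (hx : ∀ i, InBox N (x i)) :
    ∑ b ∈ bonds N, (potential N (fun i => exchange N b (x i)) - potential N x) ^ 2
      ≤ 72 * (Fintype.card ι : ℝ) ^ 4 := by
  set n : ℝ := (Fintype.card ι : ℝ)
  calc _ ≤ ∑ b ∈ bonds N, 6 * n ^ 2 * (6 * n * ∑ i, |(exchange N b (x i) : ℝ) - x i|) := by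
        refine Finset.sum_le_sum fun b _ => ?_
        rw [← sq_abs, sq]
        exact mul_le_mul (abs_potential_exchange_sub_le hx b)
          (abs_potential_sub_le hx fun i => (hx i).exchange b) (abs_nonneg _) (by positivity)
    _ = 36 * n ^ 3 * ∑ i, ∑ b ∈ bonds N, |(exchange N b (x i) : ℝ) - x i| := by
        rw [Finset.sum_comm, Finset.mul_sum]
        refine Finset.sum_congr rfl fun b _ => ?_
        ring
    _ ≤ 36 * n ^ 3 * ∑ _i : ι, (2 : ℝ) := by
        gcongr with i
        exact_mod_cast sum_abs_exchange_sub_le (hx i)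
    _ = 72 * n ^ 4 := by
        rw [Finset.sum_const, Finset.card_univ, nsmul_eq_mul]
        ring

theorem potential_exchange_of_adjacent (hinj : Function.Injective x) (hx : ∀ i, InBox N (x i))
    {i j : ι} (hij : x j = x i + 1) :
    potential N (fun m => exchange N (x i) (x m)) = potential N x := by
  classical
  have hperm : ∀ m, exchange N (x i) (x m) = x (Equiv.swap i j m) := by
    intro m
    have := hx i
    have := hx j
    unfold InBox at *
    rw [exchange, if_pos (by omega), ← hij, ← hinj.swap_apply]
  simp only [hperm]
  exact potential_comp_perm N x _

end Potential

/-! ### One step of the coupling -/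

section Coupling

variable {N n : ℕ} {σ : Equiv.Perm (Fin n)} {x z : Fin n → ℤ} {c : (Fin n → ℤ) × (Fin n → ℤ)}
  {i j ℓ : Fin n} {b : ℤ}

/-- The sites `b` and `b + 1` are occupied by the stirring particle `ℓ` and by one having priority
over it. These are the marks at which the independent particle `ℓ` does not imitate the stirring
one. -/
def Collides (σ : Equiv.Perm (Fin n)) (x : Fin n → ℤ) (ℓ : Fin n) (b : ℤ) : Prop :=
  ∃ j, σ j < σ ℓ ∧ (x ℓ = b ∧ x j = b + 1 ∨ x ℓ = b + 1 ∧ x j = b)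

/-- Admissible states of the coupled process: all particles are in `Λ_N` and the stirring ones are
at distinct sites. -/
structure Admissible (N : ℕ) (c : (Fin n → ℤ) × (Fin n → ℤ)) : Prop where
  injective : Function.Injective c.1
  stirring_inBox : ∀ i, InBox N (c.1 i)
  independent_inBox : ∀ i, InBox N (c.2 i)

/-- Signed distance between the `ℓ`-th stirring and the `ℓ`-th independent particle. -/
def discrepancy (c : (Fin n → ℤ) × (Fin n → ℤ)) (ℓ : Fin n) : ℤ := c.1 ℓ - c.2 ℓ

theorem stirringStep_true (N : ℕ) (b : ℤ) (x : Fin n → ℤ) :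
    stirringStep N b true x = fun i => exchange N b (x i) := by
  ext i
  simp only [stirringStep, exchange, true_and]
  split_ifs <;> rfl

theorem stirringStep_false (N : ℕ) (b : ℤ) (x : Fin n → ℤ) : stirringStep N b false x = x := by
  simp [stirringStep]

theorem stirringStep_apply (hx : ∀ i, InBox N (x i)) (b : ℤ) (a : Bool) (i : Fin n) :
    stirringStep N b a x i = clamp N (x i + if a = true then jump b (x i) else 0) := by
  cases a
  · simp [stirringStep_false, clamp_eq_self (hx i)]
  · simp [stirringStep_true, exchange_eq_clamp (hx i)]

open Classical in
theorem attemptedJump_eq (σ : Equiv.Perm (Fin n)) (b : ℤ) (a : Bool) (x : Fin n → ℤ) (i : Fin n) :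
    attemptedJump σ b a x i
      = if a = true ↔ ¬ Collides σ x i b then jump b (x i) else 0 := by
  unfold attemptedJump Collides jump
  by_cases hb : x i = b
  · cases a <;> simp [hb, and_comm, ← ite_not (∃ _, _)]
  by_cases hb' : x i = b + 1
  · cases a <;> simp [hb', and_comm, ← ite_not (∃ _, _)]
  simp [hb, hb']

theorem collides_iff_lt (hx : Function.Injective x) (hij : i ≠ j) (hi : x i = b ∨ x i = b + 1)
    (hj : x j = b ∨ x j = b + 1) : Collides σ x i b ↔ σ j < σ i := by
  have hne := hx.ne hij
  constructor
  · rintro ⟨m, hlt, hm⟩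
    rwa [hx (show x j = x m by omega)]
  · exact fun hlt => ⟨j, hlt, by omega⟩

theorem attemptedJump_eq_zero (hx : Function.Injective x) (hij : i ≠ j) {a : Bool}
    (hi : attemptedJump σ b a x i ≠ 0) : attemptedJump σ b a x j = 0 := by
  classical
  by_contra hj
  rw [attemptedJump_eq, Ne, ite_eq_right_iff] at hi
  rw [attemptedJump_eq, ite_eq_right_iff] at hj
  push Not at hi hj
  have hmem : ∀ m, jump b (x m) ≠ 0 → x m = b ∨ x m = b + 1 := by
    unfold jump
    grind
  have hlt_iff : σ j < σ i ↔ σ i < σ j := by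
    rw [← collides_iff_lt hx hij (hmem i hi.2) (hmem j hj.2),
      ← collides_iff_lt hx hij.symm (hmem j hj.2) (hmem i hi.2)]
    exact not_iff_not.1 (hi.1.symm.trans hj.1)
  have hne := σ.injective.ne hij
  omega

theorem abs_attemptedJump_le_one (σ : Equiv.Perm (Fin n)) (b : ℤ) (a : Bool) (x : Fin n → ℤ)
    (i : Fin n) : |attemptedJump σ b a x i| ≤ 1 := by
  unfold attemptedJump
  split_ifs <;> simp

theorem independentStep_apply (hx : Function.Injective x) (hz : ∀ i, InBox N (z i)) (b : ℤ)
    (a : Bool) (ℓ : Fin n) :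
    independentStep N σ b a x z ℓ = clamp N (z ℓ + attemptedJump σ b a x ℓ) := by
  unfold independentStep
  dsimp only
  split_ifs with hall
  · exact (clamp_eq_self (hall ℓ)).symm
  have hsuppressed : attemptedJump σ b a x ℓ = 0 ∨ ¬ InBox N (z ℓ + attemptedJump σ b a x ℓ) := by
    by_contra! hℓ
    refine hall fun i => ?_
    rcases eq_or_ne i ℓ with rfl | hi
    · exact hℓ.2
    · rw [attemptedJump_eq_zero hx hi.symm hℓ.1, add_zero]
      exact hz i
  have hone := abs_le.1 (abs_attemptedJump_le_one σ b a x ℓ)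
  have hzℓ := hz ℓ
  unfold InBox at hzℓ hsuppressed
  unfold clamp
  omega

theorem Admissible.couplingStep (hc : Admissible N c) (l : ℤ × Bool) :
    Admissible N (couplingStep N σ c l) := by
  obtain ⟨b, a⟩ := l
  unfold _root_.couplingStep
  refine ⟨?_, fun i => ?_, fun i => ?_⟩ <;> dsimp only
  · cases a
    · rw [stirringStep_false]
      exact hc.injective
    · rw [stirringStep_true]
      exact (exchange_injective N b).comp hc.injective
  · rw [stirringStep_apply hc.stirring_inBox]
    exact inBox_clamp N _
  · rw [independentStep_apply hc.injective hc.independent_inBox]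
    exact inBox_clamp N _

open Classical in
theorem abs_discrepancy_couplingStep_le (hc : Admissible N c) (b : ℤ) (a : Bool) (ℓ : Fin n) :
    |discrepancy (couplingStep N σ c (b, a)) ℓ| ≤
      |discrepancy c ℓ + if Collides σ c.1 ℓ b then
        if a = true then jump b (c.1 ℓ) else -jump b (c.1 ℓ) else 0| := by
  calc _ = |clamp N (c.1 ℓ + if a = true then jump b (c.1 ℓ) else 0)
        - clamp N (c.2 ℓ + attemptedJump σ b a c.1 ℓ)| := by
        rw [← stirringStep_apply hc.stirring_inBox,
          ← independentStep_apply hc.injective hc.independent_inBox]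
        rfl
    _ ≤ _ := abs_clamp_sub_clamp_le N _ _
    _ = _ := by
        rw [attemptedJump_eq, discrepancy]
        congr 1
        by_cases h : Collides σ c.1 ℓ b <;> cases a <;> simp [h] <;> ring

theorem Collides.potential_exchange (h : Collides σ x ℓ b) (hinj : Function.Injective x)
    (hx : ∀ i, InBox N (x i)) : potential N (fun i => exchange N b (x i)) = potential N x := by
  obtain ⟨j, -, ⟨rfl, hj⟩ | ⟨hℓ, rfl⟩⟩ := h
  · exact potential_exchange_of_adjacent hinj hx hj
  · exact potential_exchange_of_adjacent hinj hx hℓ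

theorem Collides.abs_jump (h : Collides σ x ℓ b) : |jump b (x ℓ)| = 1 := by
  obtain ⟨j, -, ⟨h, -⟩ | ⟨h, -⟩⟩ := h <;> simp [jump, h]

open Classical in
theorem sum_collides_le (s : Finset ℤ) (σ : Equiv.Perm (Fin n)) (x : Fin n → ℤ) (ℓ : Fin n) :
    ∑ b ∈ s, (if Collides σ x ℓ b then (1 : ℝ) else 0) ≤ adjacentPairs x := by
  have hsub : s.filter (Collides σ x ℓ)
      ⊆ (Finset.univ.filter fun p : Fin n × Fin n => x p.2 = x p.1 + 1).image fun p => x p.1 := by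
    intro b hb
    obtain ⟨j, -, ⟨hℓ, hj⟩ | ⟨hℓ, hj⟩⟩ := (Finset.mem_filter.1 hb).2
    · exact Finset.mem_image.2 ⟨(ℓ, j), by simp [hℓ, hj], hℓ⟩
    · exact Finset.mem_image.2 ⟨(j, ℓ), by simp [hℓ, hj], hj⟩
  rw [adjacentPairs, ← Fintype.sum_prod_type', Finset.sum_boole, Finset.sum_boole]
  exact_mod_cast (Finset.card_le_card hsub).trans Finset.card_image_le

end Coupling

/-! ### Exponential weights -/

section Cosh

variable {u v : ℝ}

theorem cosh_add_add_cosh_sub (u v : ℝ) :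
    Real.cosh (u + v) + Real.cosh (u - v) = 2 * Real.cosh v * Real.cosh u := by
  rw [Real.cosh_add, Real.cosh_sub]
  ring

theorem cosh_mul_le_cosh_mul_of_abs_le (h : |u| ≤ |v|) (a : ℝ) :
    Real.cosh (a * u) ≤ Real.cosh (a * v) := by
  rw [Real.cosh_le_cosh, abs_mul, abs_mul]
  gcongr

theorem cosh_sub_one_le_sq (hu : u ^ 2 ≤ 1) : Real.cosh u - 1 ≤ u ^ 2 := by
  have hexp : |Real.exp (u ^ 2 / 2) - 1 - u ^ 2 / 2| ≤ (u ^ 2 / 2) ^ 2 :=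
    Real.abs_exp_sub_one_sub_id_le (by rw [abs_of_nonneg (by positivity)]; linarith)
  nlinarith [(abs_le.1 hexp).2, Real.cosh_le_exp_half_sq u, sq_nonneg u]

theorem exp_div_two_le_cosh_of_le_abs (h : u ≤ |v|) : Real.exp u / 2 ≤ Real.cosh v := by
  rw [← Real.cosh_abs, Real.cosh_eq]
  have := Real.exp_le_exp.2 h
  have := Real.exp_pos (-|v|)
  linarith

end Cosh

theorem sum_exp_potential_exchange_sub_one_le {N : ℕ} {ι : Type*} [Fintype ι] {x : ι → ℤ} {α : ℝ}
    (hN : 0 < N) (hx : ∀ i, InBox N (x i)) (hα₀ : 0 ≤ α)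
    (hα : 6 * (Fintype.card ι : ℝ) ^ 2 * α ≤ 1) :
    ∑ b ∈ bonds N,
        (Real.exp (-(α * (potential N (fun i => exchange N b (x i)) - potential N x))) - 1)
      ≤ 4 * (Fintype.card ι : ℝ) ^ 2 * α / N + 72 * (Fintype.card ι : ℝ) ^ 4 * α ^ 2
        - 2 * α * adjacentPairs x := by
  set Δ : ℤ → ℝ := fun b => potential N (fun i => exchange N b (x i)) - potential N x
  have hexp : ∀ b, Real.exp (-(α * Δ b)) - 1 ≤ α ^ 2 * Δ b ^ 2 - α * Δ b := by
    intro b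
    have hsmall : |-(α * Δ b)| ≤ 1 := by
      rw [abs_neg, abs_mul, abs_of_nonneg hα₀]
      exact (mul_le_mul_of_nonneg_left (abs_potential_exchange_sub_le hx b) hα₀).trans
        (by linarith)
    linarith [(abs_le.1 (Real.abs_exp_sub_one_sub_id_le hsmall)).2]
  calc _ ≤ ∑ b ∈ bonds N, (α ^ 2 * Δ b ^ 2 - α * Δ b) := Finset.sum_le_sum fun b _ => hexp b
    _ = α ^ 2 * ∑ b ∈ bonds N, Δ b ^ 2 - α * ∑ b ∈ bonds N, Δ b := by
        rw [Finset.sum_sub_distrib, Finset.mul_sum, Finset.mul_sum]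
    _ ≤ α ^ 2 * (72 * (Fintype.card ι : ℝ) ^ 4)
          - α * (2 * adjacentPairs x - 4 * (Fintype.card ι : ℝ) ^ 2 / N) := by
        gcongr
        · exact sum_potential_exchange_sub_sq_le hx
        · exact le_sum_potential_exchange_sub hN hx
    _ = _ := by ring

theorem sum_cosh_exchange_sub_le {N : ℕ} {p q : ℤ} (hp : InBox N p) (hq : InBox N q) (α : ℝ) :
    ∑ b ∈ bonds N, (Real.cosh (α * ((exchange N b q : ℝ) - p)) - Real.cosh (α * ((q : ℝ) - p)))
      ≤ 2 * (Real.cosh α - 1) * Real.cosh (α * ((q : ℝ) - p)) := by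
  have hclamp : ∀ q' : ℤ,
      Real.cosh (α * ((clamp N q' : ℝ) - p)) ≤ Real.cosh (α * ((q' : ℝ) - p)) := by
    intro q'
    have h := abs_clamp_sub_clamp_le N q' p
    rw [clamp_eq_self hp] at h
    exact cosh_mul_le_cosh_mul_of_abs_le (by exact_mod_cast h) α
  have hsum := cosh_add_add_cosh_sub (α * ((q : ℝ) - p)) α
  have hright := hclamp (q + 1)
  have hleft := hclamp (q - 1)
  rw [Int.cast_add, Int.cast_one, show α * ((q : ℝ) + 1 - p) = α * (q - p) + α by ring] at hright
  rw [Int.cast_sub, Int.cast_one, show α * ((q : ℝ) - 1 - p) = α * (q - p) - α by ring] at hleft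
  rw [sum_exchange_sub hq fun q' => Real.cosh (α * ((q' : ℝ) - p))]
  linarith

section Lyapunov

variable {N n : ℕ} {σ : Equiv.Perm (Fin n)} {x : Fin n → ℤ} {c : (Fin n → ℤ) × (Fin n → ℤ)}
  {lam A : ℝ} {ℓ : Fin n} {b : ℤ}

/-- Exponential weight of the discrepancy `D` of the `ℓ`-th pair: `cosh (lam D)`, compensated by
the potential gained since the initial configuration `x`. -/
noncomputable def discrepancyWeight (N : ℕ) (x : Fin n → ℤ) (lam : ℝ) (ℓ : Fin n)
    (c : (Fin n → ℤ) × (Fin n → ℤ)) : ℝ :=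
  Real.cosh (lam * discrepancy c ℓ) * Real.exp (-(lam ^ 2 * (potential N c.1 - potential N x)))

/-- Exponential weight of the displacements of the stirring particles from their initial
positions `x`. It controls the compensator of `discrepancyWeight`. -/
noncomputable def displacementWeight (x : Fin n → ℤ) (lam : ℝ)
    (c : (Fin n → ℤ) × (Fin n → ℤ)) : ℝ :=
  ∑ i, Real.cosh (lam ^ 2 * ((c.1 i : ℝ) - x i))

/-- Lyapunov function of the coupled process started from `x`. -/
noncomputable def lyapunov (N : ℕ) (x : Fin n → ℤ) (lam : ℝ) (ℓ : Fin n)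
    (c : (Fin n → ℤ) × (Fin n → ℤ)) : ℝ :=
  discrepancyWeight N x lam ℓ c + displacementWeight x lam c

theorem discrepancyWeight_pos (N : ℕ) (x : Fin n → ℤ) (lam : ℝ) (ℓ : Fin n)
    (c : (Fin n → ℤ) × (Fin n → ℤ)) : 0 < discrepancyWeight N x lam ℓ c :=
  mul_pos (Real.cosh_pos _) (Real.exp_pos _)

theorem displacementWeight_nonneg (x : Fin n → ℤ) (lam : ℝ) (c : (Fin n → ℤ) × (Fin n → ℤ)) :
    0 ≤ displacementWeight x lam c :=
  Finset.sum_nonneg fun _ _ => (Real.cosh_pos _).le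

theorem lyapunov_nonneg (N : ℕ) (x : Fin n → ℤ) (lam : ℝ) (ℓ : Fin n)
    (c : (Fin n → ℤ) × (Fin n → ℤ)) : 0 ≤ lyapunov N x lam ℓ c :=
  add_nonneg (discrepancyWeight_pos N x lam ℓ c).le (displacementWeight_nonneg x lam c)

theorem lyapunov_diagonal (N : ℕ) (x : Fin n → ℤ) (lam : ℝ) (ℓ : Fin n) :
    lyapunov N x lam ℓ (x, x) = n + 1 := by
  simp [lyapunov, discrepancyWeight, displacementWeight, discrepancy, add_comm]

theorem Collides.sum_cosh_discrepancy_le (hcol : Collides σ c.1 ℓ b) (hc : Admissible N c)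
    (lam : ℝ) :
    Real.cosh (lam * discrepancy (couplingStep N σ c (b, true)) ℓ)
        + Real.cosh (lam * discrepancy (couplingStep N σ c (b, false)) ℓ)
      ≤ 2 * Real.cosh lam * Real.cosh (lam * discrepancy c ℓ) := by
  set δ := jump b (c.1 ℓ)
  have hactive := abs_discrepancy_couplingStep_le (σ := σ) hc b true ℓ
  have hpassive := abs_discrepancy_couplingStep_le (σ := σ) hc b false ℓ
  simp only [hcol, if_true, Bool.false_eq_true, if_false] at hactive hpassive
  have hlam : Real.cosh (lam * δ) = Real.cosh lam := by
    rw [← Real.cosh_abs, abs_mul, ← Int.cast_abs, hcol.abs_jump, Int.cast_one, mul_one,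
      Real.cosh_abs]
  calc _ ≤ Real.cosh (lam * ((discrepancy c ℓ + δ : ℤ) : ℝ))
        + Real.cosh (lam * ((discrepancy c ℓ + -δ : ℤ) : ℝ)) :=
        add_le_add (cosh_mul_le_cosh_mul_of_abs_le (by exact_mod_cast hactive) lam)
          (cosh_mul_le_cosh_mul_of_abs_le (by exact_mod_cast hpassive) lam)
    _ = _ := by
        rw [← hlam, ← cosh_add_add_cosh_sub]
        push_cast
        ring_nf

theorem cosh_discrepancy_couplingStep_le (hcol : ¬ Collides σ c.1 ℓ b) (hc : Admissible N c)
    (a : Bool) (lam : ℝ) :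
    Real.cosh (lam * discrepancy (couplingStep N σ c (b, a)) ℓ)
      ≤ Real.cosh (lam * discrepancy c ℓ) := by
  have h := abs_discrepancy_couplingStep_le (σ := σ) hc b a ℓ
  rw [if_neg hcol, add_zero] at h
  exact cosh_mul_le_cosh_mul_of_abs_le (by exact_mod_cast h) lam

open Classical in
theorem discrepancyWeight_couplingStep_le (hc : Admissible N c) (x : Fin n → ℤ) (lam : ℝ)
    (ℓ : Fin n) (b : ℤ) :
    discrepancyWeight N x lam ℓ (couplingStep N σ c (b, true)) - discrepancyWeight N x lam ℓ c
        + (discrepancyWeight N x lam ℓ (couplingStep N σ c (b, false))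
          - discrepancyWeight N x lam ℓ c)
      ≤ discrepancyWeight N x lam ℓ c *
        (Real.exp (-(lam ^ 2 * (potential N (fun i => exchange N b (c.1 i)) - potential N c.1))) - 1
          + 2 * (Real.cosh lam - 1) * if Collides σ c.1 ℓ b then 1 else 0) := by
  have hactive : (couplingStep N σ c (b, true)).1 = fun i => exchange N b (c.1 i) :=
    stirringStep_true N b c.1
  have hpassive : (couplingStep N σ c (b, false)).1 = c.1 := stirringStep_false N b c.1
  unfold discrepancyWeight
  rw [hactive, hpassive]
  set E := Real.exp (-(lam ^ 2 * (potential N c.1 - potential N x)))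
  have hE : 0 < E := Real.exp_pos _
  by_cases hcol : Collides σ c.1 ℓ b
  · rw [hcol.potential_exchange hc.injective hc.stirring_inBox, if_pos hcol]
    have hsum := mul_le_mul_of_nonneg_right (hcol.sum_cosh_discrepancy_le hc lam) hE.le
    simp only [sub_self, mul_zero, neg_zero, Real.exp_zero]
    linarith
  · have hexp : Real.exp (-(lam ^ 2 * (potential N (fun i => exchange N b (c.1 i))
          - potential N x)))
        = E * Real.exp (-(lam ^ 2 * (potential N (fun i => exchange N b (c.1 i))
          - potential N c.1))) := by
      rw [← Real.exp_add]
      ring_nf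
    rw [hexp, if_neg hcol]
    have htrue := mul_le_mul_of_nonneg_right (cosh_discrepancy_couplingStep_le hcol hc true lam)
      (mul_pos hE (Real.exp_pos
        (-(lam ^ 2 * (potential N (fun i => exchange N b (c.1 i)) - potential N c.1))))).le
    have hfalse := mul_le_mul_of_nonneg_right
      (cosh_discrepancy_couplingStep_le hcol hc false lam) hE.le
    linarith

theorem sum_discrepancyWeight_couplingStep_sub_le (hN : 0 < N)
    (hlam : 6 * (n : ℝ) ^ 2 * lam ^ 2 ≤ 1) (hc : Admissible N c) (x : Fin n → ℤ) (ℓ : Fin n) :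
    ∑ l ∈ letters N,
        (discrepancyWeight N x lam ℓ (couplingStep N σ c l) - discrepancyWeight N x lam ℓ c)
      ≤ 2 * (2 * (n : ℝ) ^ 2 * lam ^ 2 / N + 36 * (n : ℝ) ^ 4 * lam ^ 4)
        * discrepancyWeight N x lam ℓ c := by
  classical
  have hn : (1 : ℝ) ≤ n := by exact_mod_cast ℓ.pos
  have hcosh : Real.cosh lam - 1 ≤ lam ^ 2 :=
    cosh_sub_one_le_sq (by nlinarith [one_le_pow₀ hn (n := 2), sq_nonneg lam])
  have hcol : 2 * (Real.cosh lam - 1) * ∑ b ∈ bonds N, (if Collides σ c.1 ℓ b then (1 : ℝ) else 0)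
      ≤ 2 * lam ^ 2 * adjacentPairs c.1 := by
    gcongr
    exact sum_collides_le (bonds N) σ c.1 ℓ
  have hpotential := sum_exp_potential_exchange_sub_one_le hN hc.stirring_inBox (sq_nonneg lam)
    (by rwa [Fintype.card_fin])
  rw [Fintype.card_fin] at hpotential
  rw [sum_letters]
  refine (Finset.sum_le_sum fun b _ => discrepancyWeight_couplingStep_le hc x lam ℓ b).trans ?_
  rw [← Finset.mul_sum, Finset.sum_add_distrib, ← Finset.mul_sum, mul_comm]
  gcongr
  · exact (discrepancyWeight_pos N x lam ℓ c).le
  · calc _ ≤ _ := add_le_add hpotential hcol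
      _ = _ := by ring

theorem sum_displacementWeight_couplingStep_sub_le (hx : ∀ i, InBox N (x i)) (hc : Admissible N c)
    (lam : ℝ) :
    ∑ l ∈ letters N, (displacementWeight x lam (couplingStep N σ c l) - displacementWeight x lam c)
      ≤ 2 * (Real.cosh (lam ^ 2) - 1) * displacementWeight x lam c := by
  have hactive : ∀ b i, (couplingStep N σ c (b, true)).1 i = exchange N b (c.1 i) :=
    fun b i => congrFun (stirringStep_true N b c.1) i
  have hpassive : ∀ b, (couplingStep N σ c (b, false)).1 = c.1 :=
    fun b => stirringStep_false N b c.1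
  simp only [sum_letters, displacementWeight, hactive, hpassive, sub_self, add_zero]
  simp only [← Finset.sum_sub_distrib]
  rw [Finset.sum_comm, Finset.mul_sum]
  exact Finset.sum_le_sum fun i _ => sum_cosh_exchange_sub_le (hx i) (hc.stirring_inBox i) _

theorem sum_lyapunov_couplingStep_sub_le (hN : 0 < N) (hlam : 6 * (n : ℝ) ^ 2 * lam ^ 2 ≤ 1)
    (hx : ∀ i, InBox N (x i)) (hc : Admissible N c) (ℓ : Fin n) :
    ∑ l ∈ letters N, (lyapunov N x lam ℓ (couplingStep N σ c l) - lyapunov N x lam ℓ c)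
      ≤ 2 * (2 * (n : ℝ) ^ 2 * lam ^ 2 / N + 36 * (n : ℝ) ^ 4 * lam ^ 4)
        * lyapunov N x lam ℓ c := by
  have hn : (1 : ℝ) ≤ n := by exact_mod_cast ℓ.pos
  have hcosh : Real.cosh (lam ^ 2) - 1
      ≤ 2 * (n : ℝ) ^ 2 * lam ^ 2 / N + 36 * (n : ℝ) ^ 4 * lam ^ 4 := by
    have hlam₁ : lam ^ 2 ≤ 1 := by nlinarith [one_le_pow₀ hn (n := 2), sq_nonneg lam]
    calc Real.cosh (lam ^ 2) - 1 ≤ (lam ^ 2) ^ 2 :=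
          cosh_sub_one_le_sq (pow_le_one₀ (sq_nonneg lam) hlam₁)
      _ = 1 * lam ^ 4 := by ring
      _ ≤ 36 * (n : ℝ) ^ 4 * lam ^ 4 := by
          gcongr
          linarith [one_le_pow₀ hn (n := 4)]
      _ ≤ _ := le_add_of_nonneg_left (by positivity)
  simp only [lyapunov, add_sub_add_comm]
  rw [Finset.sum_add_distrib, mul_add]
  refine add_le_add (sum_discrepancyWeight_couplingStep_sub_le hN hlam hc x ℓ) ?_
  refine (sum_displacementWeight_couplingStep_sub_le hx hc lam).trans ?_
  gcongr
  exact displacementWeight_nonneg x lam c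

theorem exp_le_discrepancyWeight (hlam : 0 ≤ lam) (hA : A ≤ |(discrepancy c ℓ : ℝ)|)
    (hpotential : lam ^ 2 * |potential N c.1 - potential N x| ≤ lam * A / 2) :
    Real.exp (lam * A / 2) / 2 ≤ discrepancyWeight N x lam ℓ c := by
  have hcosh : Real.exp (lam * A) / 2 ≤ Real.cosh (lam * discrepancy c ℓ) := by
    refine exp_div_two_le_cosh_of_le_abs ?_
    rw [abs_mul, abs_of_nonneg hlam]
    gcongr
  have hexp : Real.exp (-(lam * A / 2))
      ≤ Real.exp (-(lam ^ 2 * (potential N c.1 - potential N x))) := by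
    gcongr
    refine le_trans ?_ hpotential
    gcongr
    exact le_abs_self _
  calc Real.exp (lam * A / 2) / 2
      = Real.exp (lam * A) / 2 * Real.exp (-(lam * A / 2)) := by
        rw [div_mul_eq_mul_div, ← Real.exp_add]
        ring_nf
    _ ≤ _ := by
        unfold discrepancyWeight
        gcongr

theorem exp_le_lyapunov (hlam : 0 ≤ lam) (hx : ∀ i, InBox N (x i)) (hc : Admissible N c)
    (hA₀ : 0 ≤ A) (hA : A ≤ |(discrepancy c ℓ : ℝ)|) :
    Real.exp (lam * A / (12 * (n : ℝ) ^ 2)) / 2 ≤ lyapunov N x lam ℓ c := by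
  have hn : (1 : ℝ) ≤ n := by exact_mod_cast ℓ.pos
  by_cases hfar : ∃ i, lam * A / (12 * (n : ℝ) ^ 2) ≤ |lam ^ 2 * ((c.1 i : ℝ) - x i)|
  · obtain ⟨i, hi⟩ := hfar
    calc _ ≤ Real.cosh (lam ^ 2 * ((c.1 i : ℝ) - x i)) := exp_div_two_le_cosh_of_le_abs hi
      _ ≤ displacementWeight x lam c :=
          Finset.single_le_sum (f := fun i => Real.cosh (lam ^ 2 * ((c.1 i : ℝ) - x i)))
            (fun i _ => (Real.cosh_pos _).le) (Finset.mem_univ i)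
      _ ≤ _ := le_add_of_nonneg_left (discrepancyWeight_pos N x lam ℓ c).le
  push Not at hfar
  have hpotential : lam ^ 2 * |potential N c.1 - potential N x| ≤ lam * A / 2 := by
    calc _ ≤ lam ^ 2 * (6 * n * ∑ i, |(c.1 i : ℝ) - x i|) := by
          gcongr
          simpa using abs_potential_sub_le hx hc.stirring_inBox
      _ = 6 * n * ∑ i, |lam ^ 2 * ((c.1 i : ℝ) - x i)| := by
          simp only [abs_mul, abs_of_nonneg (sq_nonneg lam), ← Finset.mul_sum]
          ring
      _ ≤ 6 * n * ∑ _i : Fin n, lam * A / (12 * (n : ℝ) ^ 2) := by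
          gcongr with i
          exact (hfar i).le
      _ = lam * A / 2 := by
          rw [Finset.sum_const, Finset.card_univ, Fintype.card_fin, nsmul_eq_mul]
          field_simp
          ring
  calc _ ≤ Real.exp (lam * A / 2) / 2 := by
        gcongr
        nlinarith [one_le_pow₀ hn (n := 2)]
    _ ≤ discrepancyWeight N x lam ℓ c := exp_le_discrepancyWeight hlam hA hpotential
    _ ≤ _ := le_add_of_nonneg_right (displacementWeight_nonneg x lam c)

end Lyapunov

/-! ### Tail bounds -/

section TailBound

variable {N n : ℕ} {x : Fin n → ℤ} {r t : ℝ}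

theorem marksLaw_le_abs_position_sub_le {lam A : ℝ} (hN : 0 < N) (hr : 0 < r) (ht : 0 ≤ t)
    (hlam₀ : 0 ≤ lam) (hlam : 6 * (n : ℝ) ^ 2 * lam ^ 2 ≤ 1) (hA : 0 < A) (σ : Equiv.Perm (Fin n))
    (hinj : Function.Injective x) (hx : ∀ i, InBox N (x i)) (ℓ : Fin n) :
    marksLaw r {ω | A ≤
        |(stirringPosition N σ x x ω t ℓ : ℝ) - (independentPosition N σ x x ω t ℓ : ℝ)|}
      ≤ ENNReal.ofReal (2 * (n + 1)
        * Real.exp ((2 * (n : ℝ) ^ 2 * lam ^ 2 / N + 36 * (n : ℝ) ^ 4 * lam ^ 4) * (r * t)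
          - lam * A / (12 * (n : ℝ) ^ 2))) := by
  have hinit : Admissible N (x, x) := ⟨hinj, hx, hx⟩
  have hadmissible : ∀ ω, Admissible N (coupledProcess N σ x x ω t) := fun ω =>
    List.foldlRecOn _ _ hinit fun c hc l _ => hc.couplingStep l
  set κ := 2 * (n : ℝ) ^ 2 * lam ^ 2 / N + 36 * (n : ℝ) ^ 4 * lam ^ 4
  set θ := Real.exp (lam * A / (12 * (n : ℝ) ^ 2)) / 2 with hθ
  calc _ ≤ marksLaw r (regularMarks N t ∩
        {ω | θ ≤ lyapunov N x lam ℓ (coupledProcess N σ x x ω t)}) := by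
        refine measure_mono_ae ?_
        filter_upwards [ae_waitingTime_pos hr] with ω hpos hω
        change A ≤ _ at hω
        rw [stirringPosition, independentPosition, ← Int.cast_sub] at hω
        by_cases hfin : (marksUpTo N ω t).Finite
        · exact ⟨⟨hpos, hfin⟩, exp_le_lyapunov hlam₀ hx (hadmissible ω) hA.le hω⟩
        · rw [coupledProcess, chronologicalMarks, dif_neg hfin, List.foldl_nil, sub_self,
            Int.cast_zero, abs_zero] at hω
          exact absurd hω hA.not_ge
    _ ≤ ENNReal.ofReal (Real.exp (κ * (r * t)) * lyapunov N x lam ℓ (x, x) / θ) :=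
        marksLaw_le_foldl_chronologicalMarks_le hr ht N (I := Admissible N)
          (fun _ l hc => hc.couplingStep l) (lyapunov_nonneg N x lam ℓ) (by positivity)
          (fun _ hc => sum_lyapunov_couplingStep_sub_le hN hlam hx hc ℓ) hinit (by positivity)
    _ = _ := by
        rw [lyapunov_diagonal, hθ, Real.exp_sub]
        congr 1
        field_simp

theorem inv_sqrt_mul_sqrt_mul_rpow {a M : ℝ} (ha : 0 ≤ a) (hM : 0 < M) (ζ : ℝ) :
    (√(a * √M))⁻¹ * M ^ (1 / 4 + ζ) = M ^ ζ / √a := by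
  have hroot : √(√M) = M ^ (1 / 4 : ℝ) := by
    rw [Real.sqrt_eq_rpow, Real.sqrt_eq_rpow, ← Real.rpow_mul hM.le]
    norm_num
  rw [Real.sqrt_mul ha, hroot, Real.rpow_add hM]
  field_simp

/-- Rate in the stretched exponential tail bound for the discrepancy of one of `n` pairs. -/
noncomputable def tailRate (n : ℕ) : ℝ := 1 / (12 * (n : ℝ) ^ 2 * √(6 * (n : ℝ) ^ 2))

theorem tailRate_pos (hn : 0 < n) : 0 < tailRate n := by
  unfold tailRate
  positivity

theorem marksLaw_real_rpow_le_abs_position_sub_le {S : ℝ} (hN : 0 < N) (hr : 0 < r)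
    (hM : 1 ≤ r * t) (hS : √(r * t) ≤ S * N) (σ : Equiv.Perm (Fin n))
    (hinj : Function.Injective x) (hx : ∀ i, InBox N (x i)) (ℓ : Fin n) (ζ : ℝ) :
    (marksLaw r).real {ω | (r * t) ^ (1 / 4 + ζ) ≤
        |(stirringPosition N σ x x ω t ℓ : ℝ) - (independentPosition N σ x x ω t ℓ : ℝ)|}
      ≤ 2 * (n + 1) * Real.exp (S / 3 + 1) * Real.exp (-(tailRate n * (r * t) ^ ζ)) := by
  have hn : (1 : ℝ) ≤ n := by exact_mod_cast ℓ.pos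
  have ht : 0 ≤ t := nonneg_of_mul_nonneg_right (zero_le_one.trans hM) hr
  set M := r * t
  have hM₀ : 0 < M := zero_lt_one.trans_le hM
  have hsqrt : 1 ≤ √M := Real.one_le_sqrt.2 hM
  set lam := (√(6 * (n : ℝ) ^ 2 * √M))⁻¹ with hlam
  have hlam_sq : lam ^ 2 = (6 * (n : ℝ) ^ 2 * √M)⁻¹ := by
    rw [hlam, inv_pow, Real.sq_sqrt (by positivity)]
  have hsmall : 6 * (n : ℝ) ^ 2 * lam ^ 2 ≤ 1 := by
    rw [hlam_sq, mul_inv, mul_inv_cancel_left₀ (by positivity)]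
    exact inv_le_one_of_one_le₀ hsqrt
  have hgrowth : (2 * (n : ℝ) ^ 2 * lam ^ 2 / N + 36 * (n : ℝ) ^ 4 * lam ^ 4) * M
      ≤ S / 3 + 1 := by
    have hN' : (0 : ℝ) < N := by exact_mod_cast hN
    calc _ = √M / N / 3 + 1 := by
          rw [show lam ^ 4 = (lam ^ 2) ^ 2 by ring, hlam_sq]
          nth_rw 3 [← Real.sq_sqrt hM₀.le]
          field_simp
          ring
      _ ≤ S / 3 + 1 := by
          gcongr
          rwa [div_le_iff₀ hN']
  have hdecay : lam * M ^ (1 / 4 + ζ) / (12 * (n : ℝ) ^ 2) = tailRate n * M ^ ζ := by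
    rw [hlam, inv_sqrt_mul_sqrt_mul_rpow (by positivity) hM₀, tailRate]
    field_simp
  refine ENNReal.toReal_le_of_le_ofReal (by positivity) ((marksLaw_le_abs_position_sub_le hN hr ht
    (by positivity) hsmall (by positivity) σ hinj hx ℓ).trans (ENNReal.ofReal_le_ofReal ?_))
  rw [hdecay, mul_assoc (2 * ((n : ℝ) + 1)), ← Real.exp_add]
  gcongr
  linarith

end TailBound

theorem exp_neg_mul_rpow_le {M ζ h : ℝ} (hM : 1 ≤ M) (hζ : 0 < ζ) (hh : 0 < h) (k : ℕ) :
    Real.exp (-(h * M ^ ζ)) ≤ (⌈k / ζ⌉₊.factorial / h ^ ⌈k / ζ⌉₊ : ℝ) * M ^ (-(k : ℤ)) := by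
  set p := ⌈k / ζ⌉₊
  have hM₀ : 0 < M := zero_lt_one.trans_le hM
  have hpow : M ^ k ≤ (M ^ ζ) ^ p := by
    rw [← Real.rpow_natCast, ← Real.rpow_natCast, ← Real.rpow_mul hM₀.le]
    refine Real.rpow_le_rpow_of_exponent_le hM ?_
    rw [← div_le_iff₀' hζ]
    exact Nat.le_ceil _
  have hexp := Real.pow_div_factorial_le_exp (x := h * M ^ ζ) (by positivity) p
  rw [Real.exp_neg, zpow_neg, zpow_natCast, ← div_eq_mul_inv, div_div,
    inv_le_comm₀ (Real.exp_pos _) (by positivity), inv_div]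
  refine le_trans ?_ hexp
  rw [mul_pow]
  gcongr

theorem theorem4p5 (n : ℕ) (T : ℝ) (hT : 0 < T) (ζ : ℝ) (hζ : 0 < ζ) (k : ℕ) :
    ∃ c : ℝ, ∀ (N : ℕ) (ε : ℝ), 0 < N → ε = 1 / (N : ℝ) →
      ∀ (σ : Equiv.Perm (Fin n)) (x x₀ : Fin n → ℤ),
        Function.Injective x → (∀ i, -(N : ℤ) ≤ x i ∧ x i ≤ N) → x = x₀ →
        ∀ (ℓ : Fin n) (t : ℝ), 0 < t → t ≤ T →
          (marksLaw (ε ^ (-2 : ℤ))).real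
              {ω | (ε ^ (-2 : ℤ) * t) ^ (1 / 4 + ζ) ≤
                |(stirringPosition N σ x x₀ ω t ℓ : ℝ) - (independentPosition N σ x x₀ ω t ℓ : ℝ)|}
            ≤ c * (ε ^ (-2 : ℤ) * t) ^ (-(k : ℤ)) := by
  set C : ℝ := 2 * (n + 1) * Real.exp (√T / 3 + 1)
  set D : ℝ := ⌈k / ζ⌉₊.factorial / tailRate n ^ ⌈k / ζ⌉₊
  refine ⟨max 1 (C * D), ?_⟩
  rintro N ε hN hε σ x _ hinj hx rfl ℓ t ht htT
  have hr : ε ^ (-2 : ℤ) = (N : ℝ) ^ 2 := by simp [hε, zpow_ofNat]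
  have hr₀ : 0 < ε ^ (-2 : ℤ) := by rw [hr]; positivity
  have := isProbabilityMeasure_marksLaw hr₀
  rcases le_total (ε ^ (-2 : ℤ) * t) 1 with hM₁ | hM₁
  · exact measureReal_le_one.trans (one_le_mul_of_one_le_of_one_le (le_max_left _ _)
      (one_le_zpow_of_nonpos₀ (mul_pos hr₀ ht) hM₁ (by simp)))
  have hS : √(ε ^ (-2 : ℤ) * t) ≤ √T * N := by
    rw [hr, Real.sqrt_mul (by positivity), Real.sqrt_sq (by positivity), mul_comm]
    gcongr
  calc _ ≤ C * Real.exp (-(tailRate n * (ε ^ (-2 : ℤ) * t) ^ ζ)) :=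
        marksLaw_real_rpow_le_abs_position_sub_le hN hr₀ hM₁ hS σ hinj hx ℓ ζ
    _ ≤ C * (D * (ε ^ (-2 : ℤ) * t) ^ (-(k : ℤ))) := by
        gcongr
        exact exp_neg_mul_rpow_le hM₁ hζ (tailRate_pos ℓ.pos) k
    _ ≤ _ := by
        rw [← mul_assoc]
        gcongr
        exact le_max_right 1 (C * D)
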